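/- Let $p$ be an odd prime, $V$ an $n$-dimensional vector space over $\mathbb{F}_p$ with a nondegenerate symmetric bilinear form $\langle\cdot,\cdot\rangle$, and $\xi=e^{2\pi\sqrt{-1}/p}$. For $f:V\to\mathbb{F}_p$ put $W_f(\alpha)=\sum_{x\in V}\xi^{f(x)-\langle\alpha,x\rangle}$. The function $f$ is $s$-plateaued ($0\le s\le n$) if $|W_f(\alpha)|\in\{0,p^{(n+s)/2}\}$ for all $\alpha\in V$; its Walsh support is $S=\{\alpha:|W_f(\alpha)|=p^{(n+s)/2}\}$. Let $\mu=1$ if $p^{n+s}\equiv1\pmod 4$ and $\mu=\sqrt{-1}$ if $p^{n+s}\equiv3\pmod 4$. For $\alpha\in S$ one has $W_f(\alpha)=\pm\mu p^{(n+s)/2}\xi^{f^*(\alpha)}$ with a unique function $f^*:S\to\mathbb{F}_p$, the dual of $f$; $B_+(f)$ and $B_-(f)$ are the sets of $\alpha\in S$ for which the sign is $+$ and $-$, respectively, and $\epsilon_\alpha=\pm1$ for $\alpha\in B_\pm(f)$. Put $W_{f^*}(\alpha)=\sum_{x\in S}\xi^{f^*(x)-\langle\alpha,x\rangle}$ and $B_\pm(f^*)=\{\alpha\in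 V: W_{f^*}(\alpha)=\pm\mu p^{(n-s)/2}\xi^{f(-\alpha)}\}$. Let $\mathscr{F}$ be the set of $s$-plateaued functions $f:V\to\mathbb{F}_p$ such that: (1) $f(0)=0$; (2) $f^*$ is bent relative to $S$, that is, $|W_{f^*}(\alpha)|=(\#S)^{1/2}$ for all $\alpha\in V$; (3) $aB_+(f^*)\subseteq B_+(f^*)$ and $aB_-(f^*)\subseteq B_-(f^*)$ for all $a\in\mathbb{F}_p^*$; (4) there are integers $t,t'\in[2,p-1]$ with $\gcd(t-1,p-1)=\gcd(t'-1,p-1)=1$ such that, for all $a\in\mathbb{F}_p^*$, $f(ax)=a^tf(x)$ for $x\in B_+(f^*)$ and $f(ax)=a^{t'}f(x)$ for $x\in B_-(f^*)$. Let $0\le s\le n-4$ if $n+s$ is even and $0\le s\le n-3$ if $n+s$ is odd, and let $f\in\mathscr{F}$ be $s$-plateaued. Let $D_{f,sq}$ and $D_{f,nsq}$ be the sets of $x\in V$ for which $f(x)$ is a nonzero square and a nonsquare, respectively, in $\mathbb{F}_p$. Let $\widetilde{D}_{f,sq}\subseteq D_{f,sq}$ be any subset such that the sets $a\widetilde{D}_{f,sq}$,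 $a\in\mathbb{F}_p^*$, are pairwise disjoint with union $D_{f,sq}$, and let $\widetilde{D}_{f,nsq}\subseteq D_{f,nsq}$ be any subset with the same property for $D_{f,nsq}$. Let $$\widetilde{\mathcal C}_{D_{f,sq}}=\{(\langle a,x\rangle)_{x\in\widetilde{D}_{f,sq}}:a\in V\},\qquad \widetilde{\mathcal C}_{D_{f,nsq}}=\{(\langle a,x\rangle)_{x\in\widetilde{D}_{f,nsq}}:a\in V\},$$ and let $\perp$ denote the dual code with respect to the standard dot product. Then $0\in S$, so that $\epsilon_0=\pm1$, and the following hold. If $n+s$ is even, then $\widetilde{\mathcal C}_{D_{f,sq}}^{\perp}$ and $\widetilde{\mathcal C}_{D_{f,nsq}}^{\perp}$ are $p$-ary linear codes of length $N=\frac{1}{2}\bigl(p^{n-1}-\epsilon_0p^{\frac{n+s}{2}-1}\bigr)$, dimension $N-n$ and minimum distance $3$. If $n+s$ is odd, then $\widetilde{\mathcal C}_{D_{f,sq}}^{\perp}$ has length $N=\frac{1}{2}\bigl(p^{n-1}+\epsilon_0p^{\frac{n+s-1}{2}}\bigr)$ and dimension $N-n$, and its minimum distance is $3$ except when $p=3$,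 $n=3$ and $0\in B_-(f)$; and $\widetilde{\mathcal C}_{D_{f,nsq}}^{\perp}$ has length $N'=\frac{1}{2}\bigl(p^{n-1}-\epsilon_0p^{\frac{n+s-1}{2}}\bigr)$ and dimension $N'-n$, and its minimum distance is $3$ except when $p=3$, $n=3$ and $0\in B_+(f)$. In the two exceptional cases the code in question does not have minimum distance $3$ (it is the zero code). -/

import Mathlib

namespace PlateauedCode

noncomputable section

open Module

/-! Codes over `ZMod p`, as subspaces of `ι → ZMod p`; the length is the number of coordinates. -/

section Codes

variable {p : ℕ} {ι : Type*} [Fintype ι]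

/-- The length of a code with coordinate positions `ι`. -/
def codeLength (_C : Submodule (ZMod p) (ι → ZMod p)) : ℕ := Fintype.card ι

/-- The dual code: all words orthogonal to every codeword for the standard dot product. -/
def dualCode (C : Submodule (ZMod p) (ι → ZMod p)) : Submodule (ZMod p) (ι → ZMod p) where
  carrier := {x | ∀ y ∈ C, ∑ i, x i * y i = 0}
  zero_mem' := by intro y _; simp
  add_mem' := by
    intro a b ha hb y hy
    simp only [Pi.add_apply, add_mul, Finset.sum_add_distrib, ha y hy, hb y hy, add_zero]
  smul_mem' := by
    intro c a ha y hy
    simp only [Pi.smul_apply, smul_eq_mul, mul_assoc, ← Finset.mul_sum, ha y hy, mul_zero]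

/-- `C` has minimum Hamming distance `d`: the least distance between two distinct codewords
exists and equals `d` (so the zero code has no minimum distance). -/
def HasMinDist (C : Submodule (ZMod p) (ι → ZMod p)) (d : ℕ) : Prop :=
  IsLeast {m : ℕ | ∃ x ∈ C, ∃ y ∈ C, x ≠ y ∧ hammingDist x y = m} d

end Codes

section Functions

variable {p : ℕ} [Fact p.Prime] {V : Type*} [AddCommGroup V] [Module (ZMod p) V] [Fintype V]

/-- The code with defining set `D`: the words `(⟨a, x⟩)_{x ∈ D}` for `a ∈ V`. -/
def definingSetCode (B : LinearMap.BilinForm (ZMod p) V) (D : Finset V) :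
    Submodule (ZMod p) (D → ZMod p) :=
  LinearMap.range (LinearMap.pi fun x : D => B.flip (x : V))

/-- `∑_{x ∈ S} ξ ^ (g x - ⟨α, x⟩)` with `ξ = exp (2 π i / p)`. -/
def walshOn (B : LinearMap.BilinForm (ZMod p) V) (S : Finset V) (g : V → ZMod p) (α : V) : ℂ :=
  ∑ x ∈ S, ZMod.stdAddChar (g x - B α x)

/-- The Walsh transform of `f`. -/
def walsh (B : LinearMap.BilinForm (ZMod p) V) (f : V → ZMod p) (α : V) : ℂ :=
  walshOn B Finset.univ f α

/-- `p ^ (m / 2)` as a real number. -/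
def halfPow (p m : ℕ) : ℝ := Real.sqrt p ^ m

/-- `f` is `s`-plateaued. -/
def IsPlateaued (B : LinearMap.BilinForm (ZMod p) V) (f : V → ZMod p) (s : ℕ) : Prop :=
  s ≤ finrank (ZMod p) V ∧
    ∀ α, ‖walsh B f α‖ = 0 ∨ ‖walsh B f α‖ = halfPow p (finrank (ZMod p) V + s)

open Classical in
/-- The Walsh support of an `s`-plateaued function. -/
def walshSupport (B : LinearMap.BilinForm (ZMod p) V) (f : V → ZMod p) (s : ℕ) : Finset V :=
  Finset.univ.filter fun α => ‖walsh B f α‖ = halfPow p (finrank (ZMod p) V + s)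

/-- `g`, regarded as a function on `S`, is bent relative to `S`. -/
def IsBentRelativeTo (B : LinearMap.BilinForm (ZMod p) V) (S : Finset V) (g : V → ZMod p) :
    Prop :=
  ∀ α, ‖walshOn B S g α‖ = Real.sqrt S.card

/-- `μ = 1` if `p ^ m ≡ 1 mod 4`, and `μ = √-1` otherwise (that is, if `p ^ m ≡ 3 mod 4`,
for odd `p`). -/
def mu (p m : ℕ) : ℂ := if p ^ m % 4 = 1 then 1 else Complex.I

/-- The constant `μ p ^ ((n + s) / 2)`. -/
def amplitude (p n s : ℕ) : ℂ := mu p (n + s) * (halfPow p (n + s) : ℂ)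

open Classical in
/-- The dual `f*` of an `s`-plateaued function: on the Walsh support it is the exponent `j` with
`walsh B f α = ± μ p ^ ((n + s) / 2) ξ ^ j` (such `j` is unique, `p` being odd). Values outside the
Walsh support are irrelevant. -/
def dualFun (B : LinearMap.BilinForm (ZMod p) V) (f : V → ZMod p) (s : ℕ) (α : V) : ZMod p :=
  if h : ∃ j : ZMod p,
      walsh B f α = amplitude p (finrank (ZMod p) V) s * ZMod.stdAddChar j ∨
      walsh B f α = -(amplitude p (finrank (ZMod p) V) s * ZMod.stdAddChar j)
  then h.choose else 0

/-- `B₊(f)`. -/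
def Bplus (B : LinearMap.BilinForm (ZMod p) V) (f : V → ZMod p) (s : ℕ) : Set V :=
  {α | α ∈ walshSupport B f s ∧
    walsh B f α = amplitude p (finrank (ZMod p) V) s * ZMod.stdAddChar (dualFun B f s α)}

/-- `B₋(f)`. -/
def Bminus (B : LinearMap.BilinForm (ZMod p) V) (f : V → ZMod p) (s : ℕ) : Set V :=
  {α | α ∈ walshSupport B f s ∧
    walsh B f α = -(amplitude p (finrank (ZMod p) V) s * ZMod.stdAddChar (dualFun B f s α))}

open Classical in
/-- The sign `ε_α`: `1` on `B₊(f)`, `-1` on `B₋(f)` (and `0` off the Walsh support). -/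
def walshSign (B : LinearMap.BilinForm (ZMod p) V) (f : V → ZMod p) (s : ℕ) (α : V) : ℤ :=
  if α ∈ Bplus B f s then 1 else if α ∈ Bminus B f s then -1 else 0

/-- The Walsh transform of the dual `f*`, as a function on the Walsh support of `f`. -/
def walshDual (B : LinearMap.BilinForm (ZMod p) V) (f : V → ZMod p) (s : ℕ) (α : V) : ℂ :=
  walshOn B (walshSupport B f s) (dualFun B f s) α

/-- `B₊(f*)`. -/
def BplusDual (B : LinearMap.BilinForm (ZMod p) V) (f : V → ZMod p) (s : ℕ) : Set V :=
  {α | walshDual B f s α = mu p (finrank (ZMod p) V + s) *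
    (halfPow p (finrank (ZMod p) V - s) : ℂ) * ZMod.stdAddChar (f (-α))}

/-- `B₋(f*)`. -/
def BminusDual (B : LinearMap.BilinForm (ZMod p) V) (f : V → ZMod p) (s : ℕ) : Set V :=
  {α | walshDual B f s α = -(mu p (finrank (ZMod p) V + s) *
    (halfPow p (finrank (ZMod p) V - s) : ℂ) * ZMod.stdAddChar (f (-α)))}

/-- `f` is an `s`-plateaued function of the class `𝓕`. -/
structure InClassF (B : LinearMap.BilinForm (ZMod p) V) (f : V → ZMod p) (s : ℕ) : Prop where
  plateaued : IsPlateaued B f s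
  map_zero : f 0 = 0
  dual_bent : IsBentRelativeTo B (walshSupport B f s) (dualFun B f s)
  smul_plus : ∀ x ∈ BplusDual B f s, ∀ a : ZMod p, a ≠ 0 → a • x ∈ BplusDual B f s
  smul_minus : ∀ x ∈ BminusDual B f s, ∀ a : ZMod p, a ≠ 0 → a • x ∈ BminusDual B f s
  form_plus : ∃ t : ℕ, 2 ≤ t ∧ t ≤ p - 1 ∧ Nat.gcd (t - 1) (p - 1) = 1 ∧
    ∀ a : ZMod p, a ≠ 0 → ∀ x ∈ BplusDual B f s, f (a • x) = a ^ t * f x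
  form_minus : ∃ t : ℕ, 2 ≤ t ∧ t ≤ p - 1 ∧ Nat.gcd (t - 1) (p - 1) = 1 ∧
    ∀ a : ZMod p, a ≠ 0 → ∀ x ∈ BminusDual B f s, f (a • x) = a ^ t * f x

/-- `D_{f,sq}`: the points where `f` is a nonzero square. -/
def Dsq (f : V → ZMod p) : Set V := {x | f x ≠ 0 ∧ IsSquare (f x)}

/-- `D_{f,nsq}`: the points where `f` is a nonsquare. -/
def Dnsq (f : V → ZMod p) : Set V := {x | f x ≠ 0 ∧ ¬ IsSquare (f x)}

/-- The sets `a E`, for `a` in `F_p^*`, form a partition of `D`. -/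
structure IsScalarTransversal (D : Set V) (E : Finset V) : Prop where
  union : (⋃ a : (ZMod p)ˣ, (fun x : V => (a : ZMod p) • x) '' (E : Set V)) = D
  disjoint : ∀ a b : (ZMod p)ˣ, a ≠ b →
    Disjoint ((fun x : V => (a : ZMod p) • x) '' (E : Set V))
      ((fun x : V => (b : ZMod p) • x) '' (E : Set V))

end Functions

end

end PlateauedCode

/-! By nondegeneracy the dual code is the space of linear relations among the vectors of the
transversal E of D. Its dimension is N - n exactly when E spans V. Vectors of E are nonzero and
pairwise non-proportional, so a nonzero relation involves at least three of them; weight 3 occurs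
once D contains three pairwise independent vectors with sum zero.

Length. W_f(0) is the sum of the numbers N_j of solutions of f = j, weighted by ξ^j. An element of
ℤ[ξ] of squared modulus p^m is ±μ p^(m/2) ξ^k (`exists_eq_amplitude_of_norm_sq`): p is totally
ramified, so the element is a unit times a power of the Gauss sum, the unit is a root of unity by
Kronecker's theorem, and Gauss's sign determination identifies μ. Since rational relations between
the ξ^j are trivial, W_f(0) determines all N_j. The transversals make the number of x with f(x) ≠ 0
divisible by the even number p - 1; this parity excludes W_f(0) = 0 and f*(0) ≠ 0, leaving W_f(0) =
ε₀ μ p^((n+s)/2).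

Spanning. The nonzero frequencies of the indicator of a level set are bounded through the Walsh
values (`norm_indicatorTransform_le`). A level set in a hyperplane would have one equal to its size,
which is too large (`exists_bilin_ne_zero`).

Triples. For p ≥ 5, D is dense enough for a packing argument (`exists_zero_sum_triple_of_card`). For
p = 3 its density is about 1/3, and the third moment of the Fourier transform is used instead
(`exists_zero_sum_triple_of_third_moment`). This fails only for n = 3 with the smaller odd-case
length, where N = 3 = n and the dual is zero. -/

namespace PlateauedCode

open Polynomial

/-! ### Rational relations between p-th roots of unity and Galois conjugation. -/

section CyclotomicRelations

variable {p : ℕ} [Fact p.Prime]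

theorem stdAddChar_natCast (k : ℕ) :
    ZMod.stdAddChar (k : ZMod p) = (ZMod.stdAddChar (1 : ZMod p) : ℂ) ^ k := by
  rw [← AddChar.map_nsmul_eq_pow, nsmul_one]

theorem isPrimitiveRoot_stdAddChar {a : ZMod p} (ha : a ≠ 0) :
    IsPrimitiveRoot (ZMod.stdAddChar a : ℂ) p := by
  have hp : p.Prime := Fact.out
  refine IsPrimitiveRoot.iff_orderOf.2 (orderOf_eq_prime ?_ ?_)
  · rw [← AddChar.map_nsmul_eq_pow]; simp
  · intro h
    rw [← (ZMod.stdAddChar (N := p)).map_zero_eq_one] at h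
    exact ha (ZMod.injective_stdAddChar h)

theorem sum_univ_zmod_eq_sum_range {M : Type*} [AddCommMonoid M] (g : ZMod p → M) :
    ∑ j, g j = ∑ i ∈ Finset.range p, g (i : ZMod p) := by
  refine Finset.sum_bij' (fun j _ => j.val) (fun i _ => (i : ZMod p)) ?_ ?_ ?_ ?_ ?_
  · intro j _; exact Finset.mem_range.2 (ZMod.val_lt j)
  · intro i _; exact Finset.mem_univ _
  · intro j _; exact ZMod.natCast_zmod_val j
  · intro i hi; exact ZMod.val_natCast_of_lt (Finset.mem_range.1 hi)
  · intro j _; rw [ZMod.natCast_zmod_val]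

/-- The only rational linear relations between the `p`-th roots of unity have constant
coefficients. -/
theorem coeff_eq_of_sum_stdAddChar_eq_zero (c : ZMod p → ℚ)
    (h : ∑ j, (c j : ℂ) * ZMod.stdAddChar j = 0) (i j : ZMod p) : c i = c j := by
  have hp : p.Prime := Fact.out
  set ζ : ℂ := ZMod.stdAddChar (1 : ZMod p)
  have hζ : IsPrimitiveRoot ζ p := isPrimitiveRoot_stdAddChar one_ne_zero
  let f : ℚ[X] := ∑ k ∈ Finset.range p, C (c (k : ZMod p)) * X ^ k
  have hcoeff : ∀ j : ZMod p, f.coeff j.val = c j := by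
    intro j
    simp only [f, finsetSum_coeff, coeff_C_mul, coeff_X_pow]
    rw [Finset.sum_eq_single j.val]
    · simp
    · intro b _ hb; rw [if_neg (Ne.symm hb), mul_zero]
    · intro hb; exact absurd (Finset.mem_range.2 (ZMod.val_lt j)) hb
  have hroot : aeval ζ f = 0 := by
    rw [← h, sum_univ_zmod_eq_sum_range]
    simp only [f, map_sum, map_mul, map_pow, aeval_X, aeval_C]
    exact Finset.sum_congr rfl fun k _ => by rw [stdAddChar_natCast]; rfl
  have hdvd : cyclotomic p ℚ ∣ f := by
    rw [cyclotomic_eq_minpoly_rat hζ hp.pos]; exact minpoly.dvd ℚ ζ hroot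
  obtain ⟨g, hg⟩ := hdvd
  -- The degree is at most that of the cyclotomic polynomial, so the quotient is constant and `f` is
  -- a multiple of 1 + X + ⋯ + X^(p-1).
  have hdeg : f.natDegree ≤ p - 1 := by
    refine natDegree_sum_le_of_forall_le _ _ fun k hk => ?_
    refine (natDegree_C_mul_X_pow_le _ _).trans ?_
    have := Finset.mem_range.1 hk; omega
  have hg0 : g.natDegree = 0 := by
    by_cases hgz : g = 0
    · simp [hgz]
    · rw [hg, natDegree_mul (cyclotomic_ne_zero p ℚ) hgz, natDegree_cyclotomic,
        Nat.totient_prime hp] at hdeg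
      omega
  rw [eq_C_of_natDegree_eq_zero hg0, cyclotomic_prime] at hg
  have key : ∀ j : ZMod p, c j = g.coeff 0 := by
    intro j
    rw [← hcoeff j, hg, coeff_mul_C, finsetSum_coeff]
    simp only [coeff_X_pow]
    rw [Finset.sum_ite_eq, if_pos (Finset.mem_range.2 (ZMod.val_lt j)), one_mul]
  rw [key i, key j]

theorem sum_stdAddChar_mul {z : ZMod p} (hz : z ≠ 0) :
    ∑ j : ZMod p, (ZMod.stdAddChar (z * j) : ℂ) = 0 := by
  classical
  have := AddChar.sum_mulShift z (ZMod.isPrimitive_stdAddChar p)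
  rw [if_neg hz] at this
  simpa [mul_comm] using this

/-- Galois conjugation preserves a rational value of a sum of roots of unity. -/
theorem sum_stdAddChar_mul_eq_of_eq_ratCast (c : ZMod p → ℚ) (P : ℚ)
    (h : ∑ j, (c j : ℂ) * ZMod.stdAddChar j = P) {z : ZMod p} (hz : z ≠ 0) :
    ∑ j, (c j : ℂ) * ZMod.stdAddChar (z * j) = P := by
  classical
  -- Moving `P` into the coefficient at 0 gives a vanishing relation. Its coefficients are all
  -- equal, so scaling the exponents by `z` changes nothing.
  let d : ZMod p → ℚ := fun j => c j - if j = 0 then P else 0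
  have hd : ∀ y : ZMod p, ∑ j, (d j : ℂ) * ZMod.stdAddChar (y * j)
      = ∑ j, (c j : ℂ) * ZMod.stdAddChar (y * j) - P := by
    intro y
    simp only [d, Rat.cast_sub, sub_mul, Finset.sum_sub_distrib]
    congr 1
    rw [Finset.sum_eq_single 0] <;> simp +contextual
  have h0 : ∑ j, (d j : ℂ) * ZMod.stdAddChar j = 0 := by
    have := hd 1
    simp only [one_mul] at this
    rw [this, h, sub_self]
  have hc : ∀ j, d j = d 0 := fun j => coeff_eq_of_sum_stdAddChar_eq_zero d h0 j 0
  have := hd z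
  simp only [hc] at this
  rw [← Finset.mul_sum, sum_stdAddChar_mul hz, mul_zero] at this
  exact (sub_eq_zero.1 this.symm)

theorem conj_stdAddChar (j : ZMod p) :
    (starRingEnd ℂ) (ZMod.stdAddChar j) = ZMod.stdAddChar (-j) := by
  rw [AddChar.map_neg_eq_conj]

/-- Galois conjugation preserves a rational squared absolute value of a sum of roots of unity. -/
theorem norm_sq_sum_stdAddChar_mul (c : ZMod p → ℚ) (P : ℚ)
    (h : ‖∑ j, (c j : ℂ) * ZMod.stdAddChar j‖ ^ 2 = P) {z : ZMod p} (hz : z ≠ 0) :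
    ‖∑ j, (c j : ℂ) * ZMod.stdAddChar (z * j)‖ ^ 2 = P := by
  -- The autocorrelation of `c` gives the coefficients of the squared modulus, which reduces the
  -- claim to rational values.
  let d : ZMod p → ℚ := fun j => ∑ k, c (j + k) * c k
  have key : ∀ y : ZMod p, ((‖∑ j, (c j : ℂ) * ZMod.stdAddChar (y * j)‖ ^ 2 : ℝ) : ℂ)
      = ∑ j, (d j : ℂ) * ZMod.stdAddChar (y * j) := by
    intro y
    rw [Complex.ofReal_pow, ← Complex.mul_conj', map_sum, Finset.sum_mul_sum]
    simp only [d, Rat.cast_sum, Finset.sum_mul, Rat.cast_mul]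
    rw [Finset.sum_comm, Finset.sum_comm (s := Finset.univ) (t := Finset.univ)
      (f := fun (x : ZMod p) (i : ZMod p) => ((c (x + i) : ℂ) * (c i)) * ZMod.stdAddChar (y * x))]
    refine Finset.sum_congr rfl fun k _ => ?_
    rw [← Equiv.sum_comp (Equiv.addRight k)]
    refine Finset.sum_congr rfl fun j _ => ?_
    simp only [Equiv.coe_addRight, map_mul, conj_stdAddChar, map_ratCast]
    rw [mul_mul_mul_comm, ← AddChar.map_add_eq_mul]
    congr 2
    ring
  have h1 := key 1
  simp only [one_mul] at h1
  rw [h] at h1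
  have h2 := sum_stdAddChar_mul_eq_of_eq_ratCast d P (by rw [← h1]; simp) hz
  rw [← key z] at h2
  exact_mod_cast h2

end CyclotomicRelations

end PlateauedCode

namespace PlateauedCode

open Polynomial

/-! ### The sign of the quadratic Gauss sum. -/

section GaussSign

variable {p : ℕ} [Fact p.Prime]

theorem pow_mul_prod_range {M : Type*} [CommMonoid M] (b : M) (f : ℕ → M) (h : ℕ) :
    b ^ h * ∏ i ∈ Finset.range h, f i = ∏ i ∈ Finset.range h, b * f i := by
  rw [Finset.prod_mul_distrib, Finset.prod_const, Finset.card_range]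

/-- The residues h + 1, …, 2h are the negatives of h, …, 1. -/
theorem prod_range_eq_prod_range_half {M : Type*} [CommMonoid M] {h : ℕ} (hp : p = 2 * h + 1)
    (g : ZMod p → M) :
    ∏ i ∈ Finset.range (2 * h), g ((i + 1 : ℕ) : ZMod p)
      = ∏ i ∈ Finset.range h, g ((i + 1 : ℕ) : ZMod p) * g (-((i + 1 : ℕ) : ZMod p)) := by
  rw [two_mul, Finset.prod_range_add, Finset.prod_mul_distrib]
  congr 1
  rw [← Finset.prod_range_reflect]
  refine Finset.prod_congr rfl fun i hi => ?_
  congr 1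
  have hi := Finset.mem_range.1 hi
  rw [eq_neg_iff_add_eq_zero, ← Nat.cast_add]
  have : h + (h - 1 - i) + 1 + (i + 1) = p := by omega
  rw [this, ZMod.natCast_self]

theorem cyclotomic_zmod_self : cyclotomic p (ZMod p) = (X - 1) ^ (p - 1) := by
  have hp : p.Prime := Fact.out
  have h1 : cyclotomic p (ZMod p) * (X - 1) = X ^ p - 1 := cyclotomic_prime_mul_X_sub_one _ p
  have h2 : (X - 1 : (ZMod p)[X]) ^ p = X ^ p - 1 := by rw [sub_pow_char, one_pow]
  have h3 : (X - 1 : (ZMod p)[X]) ≠ 0 := X_sub_C_ne_zero (1 : ZMod p)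
  refine mul_right_cancel₀ h3 ?_
  rw [h1, ← h2, ← pow_succ, Nat.sub_add_cancel hp.one_le]

/-- The iterates of `X d/dX` on powers of `X - 1`. -/
theorem exists_iterate_X_mul_derivative {R : Type*} [CommRing R] (d i : ℕ) (hi : i ≤ d) :
    ∃ r : R[X], (fun q : R[X] => X * derivative q)^[i] ((X - 1) ^ d) = (X - 1) ^ (d - i) * r ∧
      r.eval 1 = (d.descFactorial i : R) := by
  induction i with
  | zero => exact ⟨1, by simp, by simp⟩
  | succ i ih =>
    obtain ⟨r, hr, hr1⟩ := ih (by omega)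
    obtain ⟨e, he⟩ : ∃ e, d - i = e + 1 := ⟨d - i - 1, by omega⟩
    refine ⟨X * (C ((e + 1 : ℕ) : R) * r + (X - 1) * derivative r), ?_, ?_⟩
    · rw [Function.iterate_succ_apply', hr, he, show d - (i + 1) = e by omega]
      simp only [derivative_mul, derivative_pow, derivative_sub, derivative_X, derivative_one,
        Nat.add_sub_cancel]
      ring
    · simp only [eval_mul, eval_add, eval_X, eval_C, hr1, eval_sub, eval_one, sub_self, zero_mul,
        add_zero, one_mul]
      rw [Nat.descFactorial_succ, he, Nat.cast_mul]

theorem iterate_X_mul_derivative_sum {R : Type*} [CommRing R] (N i : ℕ) :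
    (fun q : R[X] => X * derivative q)^[i] (∑ j ∈ Finset.range N, X ^ j)
      = ∑ j ∈ Finset.range N, C ((j : R) ^ i) * X ^ j := by
  induction i with
  | zero => simp
  | succ i ih =>
    rw [Function.iterate_succ_apply', ih]
    simp only [derivative_sum, Finset.mul_sum]
    refine Finset.sum_congr rfl fun j _ => ?_
    rw [derivative_C_mul_X_pow]
    rcases j with _ | j
    · simp
    · simp only [Nat.add_sub_cancel, pow_succ, C_mul]; ring

theorem X_pow_sub_X_pow {R : Type*} [CommRing R] (a b : ℕ) :
    (X ^ a - X ^ b : R[X]) =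
      (X - 1) * (∑ i ∈ Finset.range a, X ^ i - ∑ i ∈ Finset.range b, X ^ i) := by
  rw [mul_sub, mul_geom_sum, mul_geom_sum]; ring

/-- Comparing the two sides of `∑ χ(j) ζ ^ j = e ∏ (ζ ^ a - ζ ^ (-a))` modulo `p`. -/
theorem intCast_mul_two_pow_eq {h : ℕ} (hp : p = 2 * h + 1) (h0 : 0 < h) (e : ℤ)
    (hG : ∑ j : ZMod p, ((quadraticChar (ZMod p) j : ℤ) : ℂ) * ZMod.stdAddChar j =
      e * ∏ i ∈ Finset.range h, ((ZMod.stdAddChar ((i + 1 : ℕ) : ZMod p) : ℂ) -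
        ZMod.stdAddChar (-((i + 1 : ℕ) : ZMod p)))) :
    (e : ZMod p) * 2 ^ h = (-1) ^ h := by
  classical
  have hpp : p.Prime := Fact.out
  set ζ : ℂ := ZMod.stdAddChar (1 : ZMod p)
  have hζ : IsPrimitiveRoot ζ p := isPrimitiveRoot_stdAddChar one_ne_zero
  -- An integer polynomial vanishing at ζ, hence divisible by the cyclotomic polynomial, which
  -- becomes (X - 1)^(2h) modulo p. Both terms of `f` are divisible by (X - 1)^h modulo p, and the
  -- cofactors are compared at X = 1.
  let f : ℤ[X] := ∑ j ∈ Finset.range p, C (quadraticChar (ZMod p) (j : ZMod p)) * X ^ j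
    - C e * ∏ i ∈ Finset.range h, (X ^ (i + 1) - X ^ (p - (i + 1)))
  have hroot : aeval ζ f = 0 := by
    simp only [f, map_sub, map_sum, map_mul, map_prod, map_pow, aeval_X, aeval_C]
    rw [sub_eq_zero]
    rw [sum_univ_zmod_eq_sum_range] at hG
    convert hG using 1
    · exact Finset.sum_congr rfl fun k _ => by rw [stdAddChar_natCast]; rfl
    · congr 1
      refine Finset.prod_congr rfl fun i hi => ?_
      have hi := Finset.mem_range.1 hi
      have : -((i + 1 : ℕ) : ZMod p) = ((p - (i + 1) : ℕ) : ZMod p) := by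
        rw [Nat.cast_sub (by omega), ZMod.natCast_self, zero_sub]
      rw [this, stdAddChar_natCast, stdAddChar_natCast]
  have hdvd : cyclotomic p ℤ ∣ f := by
    rw [cyclotomic_eq_minpoly hζ hpp.pos]
    exact minpoly.isIntegrallyClosed_dvd (hζ.isIntegral hpp.pos) hroot
  have hmap := Polynomial.map_dvd (Int.castRingHom (ZMod p)) hdvd
  rw [map_cyclotomic, cyclotomic_zmod_self] at hmap
  obtain ⟨q, hq⟩ := hmap
  have hp1 : p - 1 = 2 * h := by omega
  -- Modulo p, Euler's criterion gives χ(j) = j^h, so ∑ χ(j) X^j arises from (X - 1)^(2h) by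
  -- applying X d/dX h times.
  obtain ⟨r, hr, hr1⟩ := exists_iterate_X_mul_derivative (R := ZMod p) (2 * h) h (by omega)
  rw [← hp1, ← cyclotomic_zmod_self, cyclotomic_prime, iterate_X_mul_derivative_sum, hp1,
    show 2 * h - h = h by omega] at hr
  have hringChar : ringChar (ZMod p) ≠ 2 := by rw [ZMod.ringChar_zmod_n]; omega
  have hf : f.map (Int.castRingHom (ZMod p)) = (X - 1) ^ h * r - C (e : ZMod p) *
      ((X - 1) ^ h * ∏ i ∈ Finset.range h, (∑ k ∈ Finset.range (i + 1), X ^ k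
        - ∑ k ∈ Finset.range (p - (i + 1)), X ^ k)) := by
    rw [← hr]
    simp only [f, Polynomial.map_sub, Polynomial.map_mul, Polynomial.map_sum, Polynomial.map_prod,
      Polynomial.map_pow, map_X, map_C]
    congr 1
    · refine Finset.sum_congr rfl fun j _ => ?_
      congr 2
      have := quadraticChar_eq_pow_of_char_ne_two' hringChar (j : ZMod p)
      rw [ZMod.card, show p / 2 = h by omega] at this
      simpa using this
    · simp only [X_pow_sub_X_pow, Finset.prod_mul_distrib, Finset.prod_const, Finset.card_range]
      simp
  rw [hf, hp1, two_mul, pow_add] at hq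
  have h3 : (X - 1 : (ZMod p)[X]) ^ h ≠ 0 := pow_ne_zero _ (X_sub_C_ne_zero (1 : ZMod p))
  have hq' : r - C (e : ZMod p) * ∏ i ∈ Finset.range h, (∑ k ∈ Finset.range (i + 1), X ^ k
        - ∑ k ∈ Finset.range (p - (i + 1)), X ^ k) = (X - 1) ^ h * q := by
    refine mul_left_cancel₀ h3 ?_
    linear_combination hq
  have hev := congrArg (Polynomial.eval 1) hq'
  simp only [eval_sub, eval_mul, hr1, eval_C, eval_prod, eval_finsetSum, eval_pow, eval_X,
    one_pow, eval_one, sub_self, zero_pow h0.ne', zero_mul, Finset.sum_const, Finset.card_range,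
    nsmul_eq_mul, mul_one] at hev
  have hprod : ∏ i ∈ Finset.range h, (((i + 1 : ℕ) : ZMod p) - ((p - (i + 1) : ℕ) : ZMod p))
      = 2 ^ h * (h.factorial : ZMod p) := by
    rw [← Finset.prod_range_add_one_eq_factorial, Nat.cast_prod]
    rw [pow_mul_prod_range]
    refine Finset.prod_congr rfl fun i hi => ?_
    have hi := Finset.mem_range.1 hi
    rw [Nat.cast_sub (by omega), ZMod.natCast_self]; ring
  rw [hprod, sub_eq_zero] at hev
  -- Wilson's theorem in two forms: (2h)! = -1 and (2h)! = (-1)^h (h!)².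
  have hfac : (h.factorial : ZMod p) * ((2 * h).descFactorial h : ZMod p) = -1 := by
    rw [← ZMod.wilsons_lemma p, hp1, ← Nat.factorial_mul_descFactorial (show h ≤ 2 * h by omega),
      show 2 * h - h = h by omega, Nat.cast_mul]
  have hsq : (-1 : ZMod p) ^ h * (h.factorial : ZMod p) ^ 2 = -1 := by
    refine Eq.trans ?_ (ZMod.wilsons_lemma p)
    rw [hp1, ← Finset.prod_range_add_one_eq_factorial,
      ← Finset.prod_range_add_one_eq_factorial, Nat.cast_prod, Nat.cast_prod,
      prod_range_eq_prod_range_half hp (fun x : ZMod p => x), ← Finset.prod_pow,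
      pow_mul_prod_range]
    exact Finset.prod_congr rfl fun i hi => by ring
  have hne : (h.factorial : ZMod p) ^ 2 ≠ 0 := by
    intro h0; rw [h0, mul_zero] at hsq; exact (neg_ne_zero.2 one_ne_zero) hsq.symm
  refine mul_right_cancel₀ hne ?_
  rw [hsq, ← hfac, hev]; ring

/-- The square of `∏ (ζ ^ a - ζ ^ (-a))` over `0 < a < p / 2`. -/
theorem prod_stdAddChar_sub_sq {h : ℕ} (hp : p = 2 * h + 1) :
    (-1) ^ h * (∏ i ∈ Finset.range h, ((ZMod.stdAddChar ((i + 1 : ℕ) : ZMod p) : ℂ) -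
        ZMod.stdAddChar (-((i + 1 : ℕ) : ZMod p)))) ^ 2 = (p : ℂ) := by
  have hpp : p.Prime := Fact.out
  have h2 : (2 : ZMod p) ≠ 0 := by
    intro h0
    have : ((2 : ℕ) : ZMod p) = 0 := by exact_mod_cast h0
    rw [ZMod.natCast_eq_zero_iff] at this
    have := Nat.le_of_dvd two_pos this
    have := hpp.two_le
    omega
  have hμ : IsPrimitiveRoot (ZMod.stdAddChar (2 : ZMod p) : ℂ) (2 * h + 1) :=
    hp ▸ isPrimitiveRoot_stdAddChar h2
  have h3 := hμ.prod_one_sub_pow_eq_order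
  have h4 := prod_range_eq_prod_range_half hp
    (fun x : ZMod p => (ZMod.stdAddChar x : ℂ) - ZMod.stdAddChar (-x))
  have h5 := prod_range_eq_prod_range_half hp (fun x : ZMod p => -(ZMod.stdAddChar (-x) : ℂ))
  have h6 : ∏ i ∈ Finset.range (2 * h), ((ZMod.stdAddChar ((i + 1 : ℕ) : ZMod p) : ℂ) -
      ZMod.stdAddChar (-((i + 1 : ℕ) : ZMod p))) = p := by
    -- The product of 1 - ζ^(2a) over 0 < a < p is p, and the factors -ζ^(-a) for a and -a cancel.
    have : ∀ i ∈ Finset.range (2 * h), ((ZMod.stdAddChar ((i + 1 : ℕ) : ZMod p) : ℂ) -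
        ZMod.stdAddChar (-((i + 1 : ℕ) : ZMod p))) =
        -(ZMod.stdAddChar (-((i + 1 : ℕ) : ZMod p)) : ℂ) *
          (1 - (ZMod.stdAddChar (2 : ZMod p) : ℂ) ^ (i + 1)) := by
      intro i _
      rw [← AddChar.map_nsmul_eq_pow, mul_sub, mul_one, neg_mul, ← AddChar.map_add_eq_mul]
      have : -((i + 1 : ℕ) : ZMod p) + (i + 1) • 2 = ((i + 1 : ℕ) : ZMod p) := by
        rw [nsmul_eq_mul]; ring
      rw [this]; ring
    rw [Finset.prod_congr rfl this, Finset.prod_mul_distrib, h3, h5]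
    rw [Finset.prod_eq_one]
    · rw [hp]; push_cast; ring
    · intro i _
      rw [neg_mul_neg, ← AddChar.map_add_eq_mul]; simp
  rw [← h6, h4, ← Finset.prod_pow, pow_mul_prod_range]
  exact Finset.prod_congr rfl fun i hi => by rw [neg_neg]; ring

/-- Each factor is 2i sin(2πa/p) with 0 < a < p/2, so the sine is positive. The product is i^h times
a positive real number, which the squared product identifies as √p. -/
theorem prod_stdAddChar_sub {h : ℕ} (hp : p = 2 * h + 1) :
    ∏ i ∈ Finset.range h, ((ZMod.stdAddChar ((i + 1 : ℕ) : ZMod p) : ℂ) -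
        ZMod.stdAddChar (-((i + 1 : ℕ) : ZMod p))) = Complex.I ^ h * (Real.sqrt p : ℂ) := by
  have hpp : p.Prime := Fact.out
  have hp0 : (0 : ℝ) < p := by exact_mod_cast hpp.pos
  have hsin : ∀ i ∈ Finset.range h, ((ZMod.stdAddChar ((i + 1 : ℕ) : ZMod p) : ℂ) -
      ZMod.stdAddChar (-((i + 1 : ℕ) : ZMod p))) =
      Complex.I * ((2 * Real.sin (2 * Real.pi * (i + 1) / p) : ℝ) : ℂ) := by
    intro i _
    have h1 := ZMod.stdAddChar_coe (N := p) ((i + 1 : ℕ) : ℤ)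
    have h2 := ZMod.stdAddChar_coe (N := p) (-((i + 1 : ℕ) : ℤ))
    push_cast at h1 h2 ⊢
    rw [h1, h2, Complex.sin]
    have e1 : (2 * Real.pi * Complex.I * (i + 1) / p : ℂ)
      = 2 * Real.pi * (i + 1) / p * Complex.I := by ring
    have e2 : (2 * Real.pi * Complex.I * (-1 + -(i : ℂ)) / p : ℂ)
      = -(2 * Real.pi * (i + 1) / p) * Complex.I := by ring
    simp only [neg_add_rev, e1, e2]
    linear_combination (Complex.exp (2 * ↑Real.pi * (↑i + 1) / ↑p * Complex.I) -
      Complex.exp (-(2 * ↑Real.pi * (↑i + 1) / ↑p) * Complex.I)) * Complex.I_sq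
  have hsq := prod_stdAddChar_sub_sq hp
  rw [Finset.prod_congr rfl hsin, Finset.prod_mul_distrib, Finset.prod_const,
    Finset.card_range, ← Complex.ofReal_prod] at hsq ⊢
  set R : ℝ := ∏ i ∈ Finset.range h, 2 * Real.sin (2 * Real.pi * (i + 1) / p)
  have hR : 0 < R := by
    refine Finset.prod_pos fun i hi => mul_pos two_pos (Real.sin_pos_of_pos_of_lt_pi ?_ ?_)
    · positivity
    · rw [div_lt_iff₀ hp0]
      have hi := Finset.mem_range.1 hi
      have : (2 * (i + 1) : ℝ) < p := by
        have : 2 * (i + 1) < p := by omega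
        exact_mod_cast this
      nlinarith [Real.pi_pos]
  have hR2 : R ^ 2 = p := by
    have : (R : ℂ) ^ 2 = p := by
      rw [← hsq, mul_pow, ← pow_mul, mul_comm h 2, pow_mul, Complex.I_sq, ← mul_assoc,
        ← mul_pow]
      simp
    exact_mod_cast this
  rw [← hR2, Real.sqrt_sq hR.le]

/-- Gauss's evaluation of the quadratic Gauss sum. -/
theorem quadratic_gauss_sum (hp : p ≠ 2) :
    ∑ j : ZMod p, ((quadraticChar (ZMod p) j : ℤ) : ℂ) * ZMod.stdAddChar j =
      (if p % 4 = 1 then 1 else Complex.I) * (Real.sqrt p : ℂ) := by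
  classical
  have hpp : p.Prime := Fact.out
  have hodd := hpp.eq_two_or_odd.resolve_left hp
  obtain ⟨h, hh⟩ : ∃ h, p = 2 * h + 1 := ⟨p / 2, by omega⟩
  have h0 : 0 < h := by have := hpp.two_le; omega
  have hringChar : ringChar (ZMod p) ≠ 2 := by rwa [ZMod.ringChar_zmod_n]
  let χ : MulChar (ZMod p) ℂ := (quadraticChar (ZMod p)).ringHomComp (Int.castRingHom ℂ)
  have hχq : χ.IsQuadratic := (quadraticChar_isQuadratic (ZMod p)).comp _
  have hχ1 : χ ≠ 1 := by
    intro h1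
    obtain ⟨a, ha⟩ := quadraticChar_exists_neg_one hringChar
    have ha0 : a ≠ 0 := by rintro rfl; simp at ha
    have : χ a = 1 := by rw [h1, MulChar.one_apply (isUnit_iff_ne_zero.2 ha0)]
    simp only [χ, MulChar.ringHomComp_apply, ha] at this
    norm_num at this
  have hsq := gaussSum_sq hχ1 hχq (ZMod.isPrimitive_stdAddChar p)
  have hG : gaussSum χ ZMod.stdAddChar =
      ∑ j : ZMod p, ((quadraticChar (ZMod p) j : ℤ) : ℂ) * ZMod.stdAddChar j := rfl
  have hneg : χ (-1) = (-1) ^ h := by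
    have := quadraticChar_neg_one hringChar
    simp only [χ, MulChar.ringHomComp_apply, this, ZMod.card, ZMod.χ₄_eq_neg_one_pow hodd]
    rw [show p / 2 = h by omega]; simp
  rw [hG, hneg, ZMod.card] at hsq
  have hP := prod_stdAddChar_sub_sq hh
  have hPv := prod_stdAddChar_sub hh
  set P := ∏ i ∈ Finset.range h, ((ZMod.stdAddChar ((i + 1 : ℕ) : ZMod p) : ℂ) -
        ZMod.stdAddChar (-((i + 1 : ℕ) : ZMod p)))
  -- The Gauss sum and the sine product have equal squares, hence differ by a sign `e`. The
  -- congruence e · 2^h = (-1)^h modulo p determines it.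
  have hsq' : (∑ j : ZMod p, ((quadraticChar (ZMod p) j : ℤ) : ℂ) * ZMod.stdAddChar j) ^ 2
      = P ^ 2 := by
    rw [hsq, ← hP, ← mul_assoc, ← mul_pow]; simp
  obtain ⟨e, he, heG⟩ : ∃ e : ℤ, (e = 1 ∨ e = -1) ∧
      ∑ j : ZMod p, ((quadraticChar (ZMod p) j : ℤ) : ℂ) * ZMod.stdAddChar j = e * P := by
    rcases sq_eq_sq_iff_eq_or_eq_neg.1 hsq' with h1 | h1
    · exact ⟨1, Or.inl rfl, by rw [h1]; simp⟩
    · exact ⟨-1, Or.inr rfl, by rw [h1]; simp⟩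
  have hmod := intCast_mul_two_pow_eq hh h0 e heG
  rw [heG, hPv, ← mul_assoc]
  congr 1
  have h2 : ((quadraticChar (ZMod p) 2 : ℤ) : ZMod p) = 2 ^ h := by
    have := quadraticChar_eq_pow_of_char_ne_two' hringChar (2 : ZMod p)
    rwa [ZMod.card, show p / 2 = h by omega] at this
  have hne : (1 : ZMod p) ≠ -1 := (Ring.neg_one_ne_one_of_char_ne_two hringChar).symm
  -- 2^h is the quadratic character of 2, known from p modulo 8, that is, from h modulo 4; four
  -- cases remain, and in each the wrong sign would give 1 = -1 modulo p.
  rw [← h2, quadraticChar_two hringChar, ZMod.card, ZMod.χ₈_nat_mod_eight] at hmod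
  have hI : (Complex.I ^ h : ℂ) = Complex.I ^ (h % 4) := Complex.I_pow_eq_pow_mod h
  have h1 : (-1 : ZMod p) ^ h = (-1) ^ (h % 4) := by
    conv_lhs => rw [← Nat.div_add_mod h 4, pow_add, pow_mul]
    norm_num
  have h3 : p % 8 = 2 * (h % 4) + 1 := by omega
  have h4 : p % 4 = (2 * (h % 4) + 1) % 4 := by omega
  have hh4 : h % 4 < 4 := Nat.mod_lt _ (by norm_num)
  rw [h1, h3] at hmod
  rw [hI, h4]
  have c1 : ZMod.χ₈ 1 = 1 := by decide
  have c3 : ZMod.χ₈ 3 = -1 := by decide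
  have c5 : ZMod.χ₈ 5 = -1 := by decide
  have c7 : ZMod.χ₈ 7 = 1 := by decide
  generalize h % 4 = r at hmod hh4
  interval_cases r <;> rcases he with rfl | rfl <;>
    first
    | (norm_num [c1, c3, c5, c7, hne, hne.symm, pow_succ] at hmod; done)
    | norm_num [pow_succ]

end GaussSign

end PlateauedCode

namespace PlateauedCode

open Polynomial

/-! ### Cyclotomic integers of squared modulus p^m. -/

section Amplitude

variable {p : ℕ} [Fact p.Prime]

open NumberField in
/-- In the ring of integers of the `p`-th cyclotomic field, elements of squared absolute value
`p ^ m` are, up to units, powers of `ζ - 1`. -/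
theorem exists_associated_pow_of_mul_conj_eq {K : Type*} [Field K] [NumberField K]
    [IsCyclotomicExtension {p} ℚ K] [IsCMField K] {ζ : K} (hζ : IsPrimitiveRoot ζ p)
    (hZ : hζ.toInteger * IsCMField.ringOfIntegersComplexConj K hζ.toInteger = 1)
    (y : 𝓞 K) (m : ℕ) (hy : y * IsCMField.ringOfIntegersComplexConj K y = (p : 𝓞 K) ^ m) :
    ∃ a, Associated y ((hζ.toInteger - 1) ^ a) ∧ 2 * a = (p - 1) * m := by
  set σ := IsCMField.ringOfIntegersComplexConj K
  set l := hζ.toInteger - 1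
  have hl : Prime l := hζ.zeta_sub_one_prime'
  -- Total ramification: p is a unit times (ζ - 1)^(p-1), so every divisor of p^m is a unit times a
  -- power of the prime ζ - 1.
  have hpl : Associated (l ^ ((p - 1) * m)) ((p : 𝓞 K) ^ m) := by
    rw [pow_mul]
    exact (IsCyclotomicExtension.Rat.associated_zeta_sub_one_pow_prime p hζ).pow_pow
  have hdvd : y ∣ l ^ ((p - 1) * m) := by
    refine Dvd.dvd.trans ?_ hpl.symm.dvd
    exact ⟨_, hy.symm⟩
  obtain ⟨a, -, ha⟩ := (dvd_prime_pow hl _).1 hdvd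
  refine ⟨a, ha, ?_⟩
  -- The prime ζ - 1 is its own conjugate up to a unit, so y and its conjugate have the same
  -- exponent `a`, and 2a is the exponent of p^m.
  have hσl : Associated (σ l) l := by
    have hu : IsUnit (-(σ hζ.toInteger)) := by
      rw [IsUnit.neg_iff]; exact IsUnit.of_mul_eq_one_right _ hZ
    have : σ l = l * -(σ hζ.toInteger) := by
      simp only [l, map_sub, map_one]; linear_combination hZ
    rw [this]
    exact (associated_mul_unit_left _ _ hu)
  have hσy : Associated (σ y) (l ^ a) := by
    have h1 : Associated (σ y) (σ (l ^ a)) := ha.map σ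
    rw [map_pow] at h1
    exact h1.trans hσl.pow_pow
  have h2 : Associated (l ^ (2 * a)) (l ^ ((p - 1) * m)) := by
    rw [two_mul, pow_add]
    refine (ha.mul_mul hσy).symm.trans ?_
    rw [hy]; exact hpl.symm
  refine le_antisymm ?_ ?_
  · exact (pow_dvd_pow_iff hl.ne_zero hl.not_isUnit).1 h2.dvd
  · exact (pow_dvd_pow_iff hl.ne_zero hl.not_isUnit).1 h2.symm.dvd

theorem norm_stdAddChar (j : ZMod p) : ‖(ZMod.stdAddChar j : ℂ)‖ = 1 := by
  rw [ZMod.stdAddChar_apply]; exact Circle.norm_coe _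

-- The given sum and the m-th power of the Gauss sum generate the same power of the ideal of ζ - 1,
-- so they differ by a unit. That unit has modulus 1 in every embedding, hence is a root of unity by
-- Kronecker's theorem, and in this field those are the powers of -ζ.
open NumberField in
theorem exists_eq_mul_pow_of_norm_sq (K : Type*) [Field K] [NumberField K]
    [IsCyclotomicExtension {p} ℚ K] (hp : p ≠ 2) (c : ZMod p → ℤ) (m : ℕ)
    (hc : ‖∑ j, (c j : ℂ) * ZMod.stdAddChar j‖ ^ 2 = (p : ℝ) ^ m) :
    ∃ r : ℕ, ∑ j, (c j : ℂ) * ZMod.stdAddChar j =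
      (∑ j : ZMod p, ((quadraticChar (ZMod p) j : ℤ) : ℂ) * ZMod.stdAddChar j) ^ m *
        (-(ZMod.stdAddChar (1 : ZMod p) : ℂ)) ^ r := by
  have hpp : p.Prime := Fact.out
  have hp2 : 2 < p := lt_of_le_of_ne hpp.two_le (Ne.symm hp)
  have hodd : Odd p := hpp.odd_of_ne_two hp
  have hζ : IsPrimitiveRoot (IsCyclotomicExtension.zeta p ℚ K) p :=
    IsCyclotomicExtension.zeta_spec p ℚ K
  have : IsCMField K :=
    IsCyclotomicExtension.Rat.isCMField K (S := {p}) ⟨p, rfl, hp2⟩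
  have hψ : IsPrimitiveRoot (ZMod.stdAddChar (1 : ZMod p) : ℂ) p :=
    isPrimitiveRoot_stdAddChar one_ne_zero
  let e := hζ.embeddingsEquivPrimitiveRoots ℂ (cyclotomic.irreducible_rat hpp.pos)
  let φa : K →ₐ[ℚ] ℂ := e.symm ⟨ZMod.stdAddChar (1 : ZMod p),
    (mem_primitiveRoots hpp.pos).2 hψ⟩
  have hφζ : φa (IsCyclotomicExtension.zeta p ℚ K) = ZMod.stdAddChar (1 : ZMod p) := by
    have h1 := hζ.embeddingsEquivPrimitiveRoots_apply_coe ℂ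
      (cyclotomic.irreducible_rat hpp.pos) φa
    rw [← h1]
    change ((e (e.symm _) : primitiveRoots p ℂ) : ℂ) = _
    rw [Equiv.apply_symm_apply]
  -- The embedding that sends the abstract ζ to exp(2πi/p). Being injective, it carries norm
  -- identities in ℂ back to the ring of integers.
  let Φ : 𝓞 K →+* ℂ := (φa : K →+* ℂ).comp (algebraMap (𝓞 K) K)
  have hΦinj : Function.Injective Φ :=
    (φa : K →+* ℂ).injective.comp RingOfIntegers.coe_injective
  set Z : 𝓞 K := hζ.toInteger
  have hΦZ : Φ Z = ZMod.stdAddChar (1 : ZMod p) := hφζ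
  let σ := IsCMField.ringOfIntegersComplexConj K
  -- In a CM field conjugation commutes with all embeddings, so one identity u · ū = 1 controls
  -- every absolute value of u.
  have hconj : ∀ (τ : K →+* ℂ) (y : 𝓞 K), τ (σ y : K) = (starRingEnd ℂ) (τ (y : K)) := by
    intro τ y
    rw [IsCMField.coe_ringOfIntegersComplexConj, IsCMField.complexEmbedding_complexConj]
  have hΦσ : ∀ y, ((‖Φ y‖ ^ 2 : ℝ) : ℂ) = Φ (y * σ y) := by
    intro y
    rw [map_mul]
    have : Φ (σ y) = (starRingEnd ℂ) (Φ y) := hconj (φa : K →+* ℂ) y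
    rw [this, Complex.mul_conj', Complex.ofReal_pow]
  have hΦsum : ∀ d : ZMod p → ℤ, Φ (∑ j : ZMod p, (d j : 𝓞 K) * Z ^ j.val)
      = ∑ j, (d j : ℂ) * ZMod.stdAddChar j := by
    intro d
    simp only [map_sum, map_mul, map_intCast, map_pow, hΦZ]
    refine Finset.sum_congr rfl fun j _ => ?_
    rw [← stdAddChar_natCast, ZMod.natCast_zmod_val]
  have hZ : Z * σ Z = 1 := by
    apply hΦinj
    rw [← hΦσ, hΦZ, norm_stdAddChar]; simp
  let x : 𝓞 K := ∑ j : ZMod p, (c j : 𝓞 K) * Z ^ j.val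
  let g : 𝓞 K := ∑ j : ZMod p, ((quadraticChar (ZMod p) j : ℤ) : 𝓞 K) * Z ^ j.val
  have hx : x * σ x = (p : 𝓞 K) ^ m := by
    apply hΦinj
    rw [← hΦσ, hΦsum, hc]; simp
  have hg : g * σ g = (p : 𝓞 K) ^ 1 := by
    apply hΦinj
    rw [← hΦσ, hΦsum, quadratic_gauss_sum hp, norm_mul, mul_pow, Complex.norm_real,
      Real.norm_of_nonneg (Real.sqrt_nonneg _), Real.sq_sqrt (Nat.cast_nonneg _)]
    split_ifs <;> simp
  obtain ⟨a, hxa, ha⟩ := exists_associated_pow_of_mul_conj_eq hζ hZ x m hx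
  obtain ⟨b, hgb, hb⟩ := exists_associated_pow_of_mul_conj_eq hζ hZ g 1 hg
  have hab : b * m = a := by
    have : 2 * (b * m) = 2 * a := by rw [ha, ← mul_assoc, hb, mul_one]
    omega
  have hgx : Associated (g ^ m) x := by
    refine (hgb.pow_pow (n := m)).trans ?_
    rw [← pow_mul, hab]; exact hxa.symm
  obtain ⟨u, hu⟩ := hgx
  have hp0 : (p : 𝓞 K) ≠ 0 := Nat.cast_ne_zero.2 hpp.ne_zero
  have huu : (u : 𝓞 K) * σ u = 1 := by
    refine mul_left_cancel₀ (pow_ne_zero m hp0) ?_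
    rw [pow_one] at hg
    have h1 : g ^ m * u * σ (g ^ m * u) = (p : 𝓞 K) ^ m := by rw [hu, hx]
    rw [map_mul, map_pow] at h1
    rw [mul_one]
    rw [← hg] at h1 ⊢
    linear_combination h1
  obtain ⟨k, hk, hk1⟩ := Embeddings.pow_eq_one_of_norm_eq_one K ℂ (x := ((u : 𝓞 K) : K))
    (RingOfIntegers.isIntegral_coe _) (by
      intro τ
      have h1 := congrArg (fun y : 𝓞 K => τ (algebraMap (𝓞 K) K y)) huu
      simp only [map_mul, map_one] at h1
      rw [hconj, Complex.mul_conj'] at h1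
      have h2 : ‖τ ((u : 𝓞 K) : K)‖ ^ 2 = 1 := by exact_mod_cast h1
      exact (pow_eq_one_iff_of_nonneg (norm_nonneg _) two_ne_zero).1 h2)
  obtain ⟨r, hr⟩ := hζ.exists_neg_pow_of_isOfFinOrder hodd
    (isOfFinOrder_iff_pow_eq_one.2 ⟨k, hk, hk1⟩)
  refine ⟨r, ?_⟩
  rw [← hΦsum c, ← hΦsum (fun j => quadraticChar (ZMod p) j)]
  change Φ x = Φ g ^ m * _
  rw [← hu, map_mul, map_pow]
  congr 1
  change φa ((u : 𝓞 K) : K) = _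
  rw [hr, map_pow, map_neg, hφζ]

theorem pow_mod_four_of_even (hp : p ≠ 2) (k : ℕ) : p ^ (2 * k) % 4 = 1 := by
  have hpp : p.Prime := Fact.out
  have hodd := hpp.eq_two_or_odd.resolve_left hp
  have h : p ^ 2 % 4 = 1 := by
    have : p % 4 = 1 ∨ p % 4 = 3 := by omega
    rcases this with h | h <;> rw [Nat.pow_mod, h]
  rw [pow_mul, Nat.pow_mod, h, one_pow]; rfl

theorem pow_mod_four_of_odd (hp : p ≠ 2) (k : ℕ) : p ^ (2 * k + 1) % 4 = p % 4 := by
  rw [pow_succ, Nat.mul_mod, pow_mod_four_of_even hp, one_mul, Nat.mod_mod]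

theorem mu_mul_halfPow_even (hp : p ≠ 2) (k : ℕ) :
    mu p (2 * k) * (halfPow p (2 * k) : ℂ) = (p : ℂ) ^ k := by
  rw [mu, pow_mod_four_of_even hp, if_pos rfl, one_mul, halfPow, pow_mul,
    Real.sq_sqrt (Nat.cast_nonneg _)]
  simp

/-- The factor μ is exactly what turns √p into the Gauss sum; hence the amplitude has explicit
integer coefficients on the roots of unity. -/
theorem mu_mul_halfPow_odd (hp : p ≠ 2) (k : ℕ) :
    mu p (2 * k + 1) * (halfPow p (2 * k + 1) : ℂ) = (p : ℂ) ^ k *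
      ∑ j : ZMod p, ((quadraticChar (ZMod p) j : ℤ) : ℂ) * ZMod.stdAddChar j := by
  rw [mu, pow_mod_four_of_odd hp, quadratic_gauss_sum hp, halfPow, pow_succ, pow_mul,
    Real.sq_sqrt (Nat.cast_nonneg _)]
  push_cast
  ring

theorem quadratic_gauss_sum_sq (hp : p ≠ 2) :
    ∃ e : ℂ, (e = 1 ∨ e = -1) ∧
      (∑ j : ZMod p, ((quadraticChar (ZMod p) j : ℤ) : ℂ) * ZMod.stdAddChar j) ^ 2 = e * p := by
  have h : ((Real.sqrt p : ℝ) : ℂ) ^ 2 = p := by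
    rw [← Complex.ofReal_pow, Real.sq_sqrt (Nat.cast_nonneg _)]; simp
  rw [quadratic_gauss_sum hp, mul_pow, h]
  split_ifs
  · exact ⟨1, Or.inl rfl, by simp⟩
  · exact ⟨-1, Or.inr rfl, by simp⟩

/-- An integral combination of `p`-th roots of unity of squared absolute value `p ^ m` is
`± μ p ^ (m / 2)` times a `p`-th root of unity. -/
theorem exists_eq_amplitude_of_norm_sq (hp : p ≠ 2) (c : ZMod p → ℤ) (m : ℕ)
    (hc : ‖∑ j, (c j : ℂ) * ZMod.stdAddChar j‖ ^ 2 = (p : ℝ) ^ m) :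
    ∃ k : ZMod p,
      ∑ j, (c j : ℂ) * ZMod.stdAddChar j = mu p m * (halfPow p m : ℂ) * ZMod.stdAddChar k ∨
      ∑ j, (c j : ℂ) * ZMod.stdAddChar j = -(mu p m * (halfPow p m : ℂ) * ZMod.stdAddChar k) := by
  have : NeZero p := ⟨(Fact.out : p.Prime).ne_zero⟩
  have : NeZero ((p : ℕ) : ℚ) := ⟨Nat.cast_ne_zero.2 (Fact.out : p.Prime).ne_zero⟩
  have : IsCyclotomicExtension {p} ℚ (CyclotomicField p ℚ) := by
    convert! CyclotomicField.isCyclotomicExtension p ℚ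
  obtain ⟨r, hr⟩ := exists_eq_mul_pow_of_norm_sq (CyclotomicField p ℚ) hp c m hc
  refine ⟨(r : ZMod p), ?_⟩
  have hr' : (-(ZMod.stdAddChar (1 : ZMod p) : ℂ)) ^ r = (-1) ^ r * ZMod.stdAddChar (r : ZMod p) := by
    rw [stdAddChar_natCast, neg_pow]
  obtain ⟨e, he, hG⟩ := quadratic_gauss_sum_sq hp
  -- The squared Gauss sum is ±p, so its m-th power is μ p^(m/2) up to a sign.
  have hpow : ∃ e' : ℂ, (e' = 1 ∨ e' = -1) ∧
      (∑ j : ZMod p, ((quadraticChar (ZMod p) j : ℤ) : ℂ) * ZMod.stdAddChar j) ^ m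
        = e' * (mu p m * (halfPow p m : ℂ)) := by
    obtain ⟨k, rfl | rfl⟩ := Nat.even_or_odd' m
    · refine ⟨e ^ k, ?_, ?_⟩
      · rcases he with rfl | rfl
        · simp
        · exact neg_one_pow_eq_or ℂ k
      · rw [mu_mul_halfPow_even hp, pow_mul, hG, mul_pow]
    · refine ⟨e ^ k, ?_, ?_⟩
      · rcases he with rfl | rfl
        · simp
        · exact neg_one_pow_eq_or ℂ k
      · rw [mu_mul_halfPow_odd hp, pow_succ, pow_mul, hG, mul_pow]; ring
  obtain ⟨e', he', hpow⟩ := hpow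
  rw [hr, hr', hpow]
  rcases he' with rfl | rfl <;> rcases neg_one_pow_eq_or ℂ r with h | h <;> rw [h]
  · left; ring
  · right; ring
  · right; ring
  · left; ring

end Amplitude

end PlateauedCode

namespace PlateauedCode

/-! ### Value distribution of f from W_f(0). -/

section Walsh

theorem halfPow_sq (p m : ℕ) : halfPow p m ^ 2 = (p : ℝ) ^ m := by
  rw [halfPow, ← pow_mul, mul_comm, pow_mul, Real.sq_sqrt (Nat.cast_nonneg _)]

variable {p : ℕ} [Fact p.Prime]

theorem sum_stdAddChar_comp {X : Type*} [Fintype X] (g : X → ZMod p) :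
    ∑ x, (ZMod.stdAddChar (g x) : ℂ) =
      ∑ j, ((Finset.univ.filter (fun x => g x = j)).card : ℂ) * ZMod.stdAddChar j := by
  rw [← Finset.sum_fiberwise Finset.univ g]
  refine Finset.sum_congr rfl fun j _ => ?_
  rw [Finset.sum_congr rfl (g := fun _ => (ZMod.stdAddChar j : ℂ)), Finset.sum_const, nsmul_eq_mul]
  intro x hx
  rw [(Finset.mem_filter.1 hx).2]

/-- The number of points where `f` takes the value `j`. -/
def valueCount {X : Type*} [Fintype X] (f : X → ZMod p) (j : ZMod p) : ℕ :=
  (Finset.univ.filter (fun x => f x = j)).card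

theorem sum_valueCount {X : Type*} [Fintype X] (f : X → ZMod p) :
    ∑ j, valueCount f j = Fintype.card X :=
  (Finset.card_eq_sum_card_fiberwise (fun x _ => Finset.mem_coe.2 (Finset.mem_univ (f x)))).symm

variable {V : Type*} [AddCommGroup V] [Module (ZMod p) V] [Fintype V]

theorem halfPow_pos (m : ℕ) : 0 < halfPow p m := by
  have : (0 : ℝ) < p := by exact_mod_cast (Fact.out : p.Prime).pos
  exact pow_pos (Real.sqrt_pos.2 this) _

theorem exists_walsh_eq_amplitude (hp : p ≠ 2) (B : LinearMap.BilinForm (ZMod p) V)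
    (f : V → ZMod p) (m : ℕ) (α : V) (h : ‖walsh B f α‖ = halfPow p m) :
    ∃ k : ZMod p, walsh B f α = mu p m * (halfPow p m : ℂ) * ZMod.stdAddChar k ∨
      walsh B f α = -(mu p m * (halfPow p m : ℂ) * ZMod.stdAddChar k) := by
  have h1 : walsh B f α =
      ∑ j, (((Finset.univ.filter (fun x => f x - B α x = j)).card : ℤ) : ℂ) *
        ZMod.stdAddChar j := by
    rw [walsh, walshOn, sum_stdAddChar_comp]; simp
  rw [h1] at h ⊢
  exact exists_eq_amplitude_of_norm_sq hp _ m (by rw [h, halfPow_sq])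

theorem amplitude_ne_zero (n s : ℕ) : amplitude p n s ≠ 0 := by
  refine mul_ne_zero ?_ (Complex.ofReal_ne_zero.2 (halfPow_pos _).ne')
  rw [mu]; split_ifs
  · exact one_ne_zero
  · exact Complex.I_ne_zero

theorem stdAddChar_ne_zero (j : ZMod p) : (ZMod.stdAddChar j : ℂ) ≠ 0 := by
  rw [← norm_ne_zero_iff, norm_stdAddChar]; exact one_ne_zero

/-- The sign on the Walsh support. -/
theorem walshSign_of_norm_eq (hp : p ≠ 2) (B : LinearMap.BilinForm (ZMod p) V)
    (f : V → ZMod p) (s : ℕ) (α : V)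
    (h : ‖walsh B f α‖ = halfPow p (Module.finrank (ZMod p) V + s)) :
    ∃ (e : ℤ) (j : ZMod p), walshSign B f s α = e ∧
      walsh B f α = e * (amplitude p (Module.finrank (ZMod p) V) s * ZMod.stdAddChar j) ∧
      ((e = 1 ∧ α ∈ Bplus B f s ∧ α ∉ Bminus B f s) ∨
        (e = -1 ∧ α ∉ Bplus B f s ∧ α ∈ Bminus B f s)) := by
  classical
  have hS : α ∈ walshSupport B f s := by simp [walshSupport, h]
  have hex : ∃ j, walsh B f α = amplitude p (Module.finrank (ZMod p) V) s * ZMod.stdAddChar j ∨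
      walsh B f α = -(amplitude p (Module.finrank (ZMod p) V) s * ZMod.stdAddChar j) :=
    exists_walsh_eq_amplitude hp B f _ α h
  have hd : walsh B f α = amplitude p (Module.finrank (ZMod p) V) s *
        ZMod.stdAddChar (dualFun B f s α) ∨
      walsh B f α = -(amplitude p (Module.finrank (ZMod p) V) s *
        ZMod.stdAddChar (dualFun B f s α)) := by
    rw [dualFun, dif_pos hex]; exact hex.choose_spec
  have hne := mul_ne_zero (amplitude_ne_zero (p := p) (Module.finrank (ZMod p) V) s)
    (stdAddChar_ne_zero (dualFun B f s α))
  rcases hd with hd | hd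
  · have h1 : α ∈ Bplus B f s := ⟨hS, hd⟩
    have h2 : α ∉ Bminus B f s := fun h2 => hne (self_eq_neg.1 (hd.symm.trans h2.2))
    refine ⟨1, dualFun B f s α, by simp [walshSign, h1], by rw [hd]; simp, Or.inl ⟨rfl, h1, h2⟩⟩
  · have h1 : α ∈ Bminus B f s := ⟨hS, hd⟩
    have h2 : α ∉ Bplus B f s := fun h2 => hne (self_eq_neg.1 (h2.2.symm.trans hd))
    refine ⟨-1, dualFun B f s α, by simp [walshSign, h1, h2], by rw [hd]; simp,
      Or.inr ⟨rfl, h2, h1⟩⟩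

theorem walsh_zero_eq (B : LinearMap.BilinForm (ZMod p) V) (f : V → ZMod p) :
    walsh B f 0 = ∑ j, (valueCount f j : ℂ) * ZMod.stdAddChar j := by
  rw [walsh, walshOn]
  simp only [map_zero, LinearMap.zero_apply, sub_zero]
  exact sum_stdAddChar_comp f

/-- Two integral combinations of `p`-th roots of unity with the same value have coefficients that
differ by their mean difference. -/
theorem mul_coeff_sub_eq_of_sum_eq (c d : ZMod p → ℤ)
    (h : ∑ j, (c j : ℂ) * ZMod.stdAddChar j = ∑ j, (d j : ℂ) * ZMod.stdAddChar j) (j : ZMod p) :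
    (p : ℤ) * (c j - d j) = ∑ i, c i - ∑ i, d i := by
  have h0 : ∑ j, (((c j - d j : ℤ) : ℚ) : ℂ) * ZMod.stdAddChar j = 0 := by
    push_cast
    simp only [sub_mul, Finset.sum_sub_distrib, h, sub_self]
  have h1 := coeff_eq_of_sum_stdAddChar_eq_zero (fun j => ((c j - d j : ℤ) : ℚ)) h0
  have h2 : ∀ i, c i - d i = c j - d j := fun i => by exact_mod_cast h1 i j
  rw [← Finset.sum_sub_distrib, Finset.sum_congr rfl fun i _ => h2 i, Finset.sum_const,
    Finset.card_univ, ZMod.card, nsmul_eq_mul]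

theorem valueCount_of_walsh_eq_zero (B : LinearMap.BilinForm (ZMod p) V) (f : V → ZMod p)
    (h : walsh B f 0 = 0) (j : ZMod p) : (p : ℤ) * valueCount f j = Fintype.card V := by
  have := mul_coeff_sub_eq_of_sum_eq (fun j => (valueCount f j : ℤ)) (fun _ => 0) (by
    rw [walsh_zero_eq] at h; simpa using h) j
  simp only [Finset.sum_const_zero, sub_zero] at this
  rw [this, ← sum_valueCount f]; push_cast; rfl

/-- Here W_f(0) = e p^k ξ^(j₀) has a single coefficient, at j₀, and is compared with the
coefficients N_j. -/
theorem valueCount_even (hp : p ≠ 2) (B : LinearMap.BilinForm (ZMod p) V) (f : V → ZMod p)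
    {k : ℕ} {e : ℤ} {j₀ : ZMod p}
    (h : walsh B f 0 = e * (mu p (2 * k) * (halfPow p (2 * k) : ℂ) * ZMod.stdAddChar j₀))
    (j : ZMod p) :
    (p : ℤ) * valueCount f j = Fintype.card V - e * p ^ k +
      if j = j₀ then p * (e * p ^ k) else 0 := by
  classical
  rw [walsh_zero_eq, mu_mul_halfPow_even hp] at h
  have := mul_coeff_sub_eq_of_sum_eq (fun j => (valueCount f j : ℤ))
    (fun j => if j = j₀ then e * p ^ k else 0) (by
      push_cast
      rw [h, Finset.sum_eq_single j₀]
      · simp [mul_assoc]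
      · intro b _ hb; simp [hb]
      · simp) j
  have h2 : ∑ i, (valueCount f i : ℤ) = Fintype.card V := by
    rw [← sum_valueCount f]; push_cast; rfl
  rw [h2, Finset.sum_ite_eq' Finset.univ j₀, if_pos (Finset.mem_univ _), mul_sub] at this
  rw [← this]
  split_ifs <;> ring

/-- Here W_f(0) is e p^k times the Gauss sum shifted by j₀, with coefficients e p^k χ(j - j₀) of
total zero. -/
theorem valueCount_odd (hp : p ≠ 2) (B : LinearMap.BilinForm (ZMod p) V) (f : V → ZMod p)
    {k : ℕ} {e : ℤ} {j₀ : ZMod p}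
    (h : walsh B f 0 = e * (mu p (2 * k + 1) * (halfPow p (2 * k + 1) : ℂ) * ZMod.stdAddChar j₀))
    (j : ZMod p) :
    (p : ℤ) * valueCount f j = Fintype.card V +
      p * (e * p ^ k * quadraticChar (ZMod p) (j - j₀)) := by
  classical
  have hringChar : ringChar (ZMod p) ≠ 2 := by rwa [ZMod.ringChar_zmod_n]
  rw [walsh_zero_eq, mu_mul_halfPow_odd hp] at h
  have := mul_coeff_sub_eq_of_sum_eq (fun j => (valueCount f j : ℤ))
    (fun j => e * p ^ k * quadraticChar (ZMod p) (j - j₀)) (by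
      simp only [Int.cast_natCast]
      rw [h]
      refine Eq.trans ?_ (Equiv.sum_comp (Equiv.addRight j₀) _)
      push_cast
      simp only [Equiv.coe_addRight, add_sub_cancel_right, AddChar.map_add_eq_mul,
        Finset.sum_mul, Finset.mul_sum]
      exact Finset.sum_congr rfl fun i _ => by ring) j
  have h2 : ∑ i, (valueCount f i : ℤ) = Fintype.card V := by
    rw [← sum_valueCount f]; push_cast; rfl
  have h3 : ∑ i, e * (p : ℤ) ^ k * quadraticChar (ZMod p) (i - j₀) = 0 := by
    rw [← Finset.mul_sum, ← Equiv.sum_comp (Equiv.addRight j₀)]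
    simp only [Equiv.coe_addRight, add_sub_cancel_right]
    rw [quadraticChar_sum_zero hringChar, mul_zero]
  rw [h2, h3, mul_sub, sub_zero] at this
  rw [← this]; ring

end Walsh

/-! ### Transversals for scalar multiplication. -/

section Transversal

variable {p : ℕ} [Fact p.Prime] {V : Type*} [AddCommGroup V] [Module (ZMod p) V]

open Classical in
theorem IsScalarTransversal.mul_card [Fintype V] {D : Set V} {E : Finset V}
    (h : IsScalarTransversal (p := p) D E) :
    (p - 1) * E.card = (Finset.univ.filter (· ∈ D)).card := by
  have h1 : (Finset.univ.filter (· ∈ D)) =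
      Finset.univ.biUnion (fun a : (ZMod p)ˣ => E.image (fun x : V => (a : ZMod p) • x)) := by
    ext x
    rw [Finset.mem_filter, ← h.union]
    simp
  rw [h1, Finset.card_biUnion]
  · rw [Finset.sum_congr rfl (g := fun _ => E.card), Finset.sum_const, Finset.card_univ,
      ZMod.card_units, smul_eq_mul]
    intro a _
    exact Finset.card_image_of_injective _ (smul_right_injective V a.ne_zero)
  · intro a _ b _ hab
    rw [Function.onFun, ← Finset.disjoint_coe, Finset.coe_image, Finset.coe_image]
    exact h.disjoint a b hab

theorem IsScalarTransversal.subset {D : Set V} {E : Finset V}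
    (h : IsScalarTransversal (p := p) D E) {x : V} (hx : x ∈ E) : x ∈ D := by
  rw [← h.union]
  exact Set.mem_iUnion.2 ⟨1, x, hx, by simp⟩

theorem IsScalarTransversal.exists_smul {D : Set V} {E : Finset V}
    (h : IsScalarTransversal (p := p) D E) {x : V} (hx : x ∈ D) :
    ∃ a : (ZMod p)ˣ, ∃ y ∈ E, x = (a : ZMod p) • y := by
  rw [← h.union] at hx
  obtain ⟨a, y, hy, rfl⟩ := Set.mem_iUnion.1 hx
  exact ⟨a, y, hy, rfl⟩

theorem IsScalarTransversal.smul_mem {D : Set V} {E : Finset V}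
    (h : IsScalarTransversal (p := p) D E) {x : V} (hx : x ∈ D) {a : ZMod p} (ha : a ≠ 0) :
    a • x ∈ D := by
  obtain ⟨b, y, hy, rfl⟩ := h.exists_smul hx
  rw [← h.union]
  exact Set.mem_iUnion.2 ⟨Units.mk0 a ha * b, y, hy, by simp [mul_smul]⟩

theorem IsScalarTransversal.unit_eq {D : Set V} {E : Finset V}
    (h : IsScalarTransversal (p := p) D E) {x y : V} (hx : x ∈ E) (hy : y ∈ E) {a b : (ZMod p)ˣ}
    (hab : (a : ZMod p) • x = (b : ZMod p) • y) : a = b := by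
  by_contra hne
  exact Set.disjoint_left.1 (h.disjoint a b hne) ⟨x, hx, rfl⟩ ⟨y, hy, hab.symm⟩

theorem IsScalarTransversal.eq_of_smul_eq {D : Set V} {E : Finset V}
    (h : IsScalarTransversal (p := p) D E) {x y : V} (hx : x ∈ E) (hy : y ∈ E) {a b : (ZMod p)ˣ}
    (hab : (a : ZMod p) • x = (b : ZMod p) • y) : x = y := by
  have := h.unit_eq hx hy hab
  subst this
  exact (smul_right_injective V a.ne_zero) hab

/-- If 0 were in E, the sets 1 · E and (-1) · E would meet, although 1 ≠ -1 for odd p. -/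
theorem IsScalarTransversal.ne_zero (hp : p ≠ 2) {D : Set V} {E : Finset V}
    (h : IsScalarTransversal (p := p) D E) {x : V} (hx : x ∈ D) : x ≠ 0 := by
  rintro rfl
  obtain ⟨a, y, hy, hay⟩ := h.exists_smul hx
  have hy0 : y = 0 := (smul_eq_zero.1 hay.symm).resolve_left a.ne_zero
  subst hy0
  have hringChar : ringChar (ZMod p) ≠ 2 := by rwa [ZMod.ringChar_zmod_n]
  have h1 := h.unit_eq (a := 1) (b := -1) hy hy (by simp)
  have h2 := congrArg (fun u : (ZMod p)ˣ => (u : ZMod p)) h1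
  simp only [Units.val_one, Units.val_neg] at h2
  exact Ring.neg_one_ne_one_of_char_ne_two hringChar h2.symm

end Transversal

end PlateauedCode

namespace PlateauedCode

/-! ### Parity, the value W_f(0), and the sizes of the transversals. -/

section Counting

variable {p : ℕ} [Fact p.Prime]

theorem sum_comp_eq_sum_valueCount {X : Type*} [Fintype X] (f : X → ZMod p) (g : ZMod p → ℤ) :
    ∑ x, g (f x) = ∑ j, g j * valueCount f j := by
  rw [← Finset.sum_fiberwise Finset.univ f]
  refine Finset.sum_congr rfl fun j _ => ?_
  rw [Finset.sum_congr rfl (g := fun _ => g j), Finset.sum_const, nsmul_eq_mul, mul_comm]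
  · rfl
  · intro x hx
    rw [(Finset.mem_filter.1 hx).2]

-- The function χ² + χ is twice the indicator of the nonzero squares; χ² - χ plays the same role for
-- the nonsquares.
open Classical in
theorem two_mul_card_Dsq {V : Type*} [Fintype V] (f : V → ZMod p) :
    2 * ((Finset.univ.filter (· ∈ Dsq f)).card : ℤ) =
      ∑ j, (quadraticChar (ZMod p) j ^ 2 + quadraticChar (ZMod p) j) * valueCount f j := by
  rw [← sum_comp_eq_sum_valueCount f
    (fun j => quadraticChar (ZMod p) j ^ 2 + quadraticChar (ZMod p) j), Finset.card_filter]
  push_cast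
  rw [Finset.mul_sum]
  refine Finset.sum_congr rfl fun x _ => ?_
  by_cases h0 : f x = 0
  · simp [Dsq, h0]
  · by_cases hs : IsSquare (f x)
    · have := (quadraticChar_one_iff_isSquare h0).2 hs
      rw [this, if_pos ⟨h0, hs⟩]; norm_num
    · have := quadraticChar_neg_one_iff_not_isSquare.2 hs
      rw [this, if_neg (fun h => hs h.2)]; norm_num

open Classical in
theorem two_mul_card_Dnsq {V : Type*} [Fintype V] (f : V → ZMod p) :
    2 * ((Finset.univ.filter (· ∈ Dnsq f)).card : ℤ) =
      ∑ j, (quadraticChar (ZMod p) j ^ 2 - quadraticChar (ZMod p) j) * valueCount f j := by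
  rw [← sum_comp_eq_sum_valueCount f
    (fun j => quadraticChar (ZMod p) j ^ 2 - quadraticChar (ZMod p) j), Finset.card_filter]
  push_cast
  rw [Finset.mul_sum]
  refine Finset.sum_congr rfl fun x _ => ?_
  by_cases h0 : f x = 0
  · simp [Dnsq, h0]
  · by_cases hs : IsSquare (f x)
    · have := (quadraticChar_one_iff_isSquare h0).2 hs
      rw [this, if_neg (fun h => h.2 hs)]; norm_num
    · have := quadraticChar_neg_one_iff_not_isSquare.2 hs
      rw [this, if_pos ⟨h0, hs⟩]; norm_num

theorem sum_quadraticChar_sq : ∑ j : ZMod p, quadraticChar (ZMod p) j ^ 2 = (p : ℤ) - 1 := by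
  have hpp : p.Prime := Fact.out
  rw [← Finset.sum_erase_add _ _ (Finset.mem_univ (0 : ZMod p)), Finset.sum_congr rfl
    (g := fun _ => 1) (fun j hj => quadraticChar_sq_one (Finset.ne_of_mem_erase hj))]
  simp [Finset.card_erase_of_mem, Nat.cast_sub hpp.one_le]

theorem quadraticChar_pow_three (j : ZMod p) :
    quadraticChar (ZMod p) j ^ 3 = quadraticChar (ZMod p) j := by
  by_cases hj : j = 0
  · simp [hj]
  · rw [pow_succ, quadraticChar_sq_one hj, one_mul]

theorem valueCount_zero_add {X : Type*} [Fintype X] (f : X → ZMod p) :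
    (valueCount f 0 : ℤ) + ∑ j, quadraticChar (ZMod p) j ^ 2 * valueCount f j
      = Fintype.card X := by
  rw [← sum_valueCount f]
  push_cast
  rw [← Finset.sum_erase_add _ _ (Finset.mem_univ (0 : ZMod p)),
    ← Finset.sum_erase_add _ _ (Finset.mem_univ (0 : ZMod p)), Finset.sum_congr rfl
    (g := fun j => (valueCount f j : ℤ)) (fun j hj => by
      rw [quadraticChar_sq_one (Finset.ne_of_mem_erase hj), one_mul])]
  simp [add_comm]

variable {V : Type*} [AddCommGroup V] [Module (ZMod p) V] [Fintype V]
  {f : V → ZMod p} {E E' : Finset V}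

theorem card_eq_pow_finrank_zmod :
    (Fintype.card V : ℤ) = (p : ℤ) ^ Module.finrank (ZMod p) V := by
  rw [Module.card_eq_pow_finrank (K := ZMod p) (V := V), ZMod.card]; push_cast; rfl

theorem IsScalarTransversal.two_mul_card_sq (h : IsScalarTransversal (p := p) (Dsq f) E) :
    2 * (((p : ℤ) - 1) * E.card) =
      ∑ j, (quadraticChar (ZMod p) j ^ 2 + quadraticChar (ZMod p) j) * valueCount f j := by
  classical
  rw [← two_mul_card_Dsq, ← h.mul_card]
  push_cast [Nat.cast_sub (Fact.out : p.Prime).one_le]; rfl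

theorem IsScalarTransversal.two_mul_card_nsq (h : IsScalarTransversal (p := p) (Dnsq f) E) :
    2 * (((p : ℤ) - 1) * E.card) =
      ∑ j, (quadraticChar (ZMod p) j ^ 2 - quadraticChar (ZMod p) j) * valueCount f j := by
  classical
  rw [← two_mul_card_Dnsq, ← h.mul_card]
  push_cast [Nat.cast_sub (Fact.out : p.Prime).one_le]; rfl

/-- The points with f ≠ 0 fall into classes of size p - 1, which is even, while V has odd
cardinality. -/
theorem odd_valueCount_zero (hp : p ≠ 2) (h : IsScalarTransversal (p := p) (Dsq f) E)
    (h' : IsScalarTransversal (p := p) (Dnsq f) E') : Odd (valueCount f 0 : ℤ) := by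
  have hodd : Odd (p : ℤ) := by exact_mod_cast (Fact.out : p.Prime).odd_of_ne_two hp
  have h1 := h.two_mul_card_sq
  have h2 := h'.two_mul_card_nsq
  have h3 := valueCount_zero_add f
  rw [card_eq_pow_finrank_zmod (p := p)] at h3
  have h4 : ∑ j, quadraticChar (ZMod p) j ^ 2 * (valueCount f j : ℤ)
      = ((p : ℤ) - 1) * (E.card + E'.card) := by
    have : 2 * ∑ j, quadraticChar (ZMod p) j ^ 2 * (valueCount f j : ℤ)
        = 2 * (((p : ℤ) - 1) * (E.card + E'.card)) := by
      rw [mul_add, mul_add, h1, h2, Finset.mul_sum, ← Finset.sum_add_distrib]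
      exact Finset.sum_congr rfl fun j _ => by ring
    linarith
  have h5 : (valueCount f 0 : ℤ) =
      (p : ℤ) ^ Module.finrank (ZMod p) V - ((p : ℤ) - 1) * (E.card + E'.card) := by
    rw [← h4]; linarith
  rw [h5]
  exact (hodd.pow).sub_even ((hodd.sub_odd odd_one).mul_right _)

/-- If W_f(0) = 0, all values are equally frequent and 2p|E| = p^n, which is odd. This gives 0 ∈ S.
-/
theorem walsh_zero_ne_zero (hp : p ≠ 2) (B : LinearMap.BilinForm (ZMod p) V)
    (h : IsScalarTransversal (p := p) (Dsq f) E) : walsh B f 0 ≠ 0 := by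
  intro h0
  have hpp : p.Prime := Fact.out
  have hringChar : ringChar (ZMod p) ≠ 2 := by rwa [ZMod.ringChar_zmod_n]
  have hodd : Odd (p : ℤ) := by exact_mod_cast hpp.odd_of_ne_two hp
  have h1 := valueCount_of_walsh_eq_zero B f h0
  rw [card_eq_pow_finrank_zmod (p := p)] at h1
  have h2 : (p : ℤ) * (2 * (((p : ℤ) - 1) * E.card)) =
      ((p : ℤ) - 1) * p ^ Module.finrank (ZMod p) V := by
    rw [h.two_mul_card_sq, Finset.mul_sum, Finset.sum_congr rfl (g := fun j =>
      (quadraticChar (ZMod p) j ^ 2 + quadraticChar (ZMod p) j) *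
        (p : ℤ) ^ Module.finrank (ZMod p) V) (fun j _ => by rw [← h1 j]; ring),
      ← Finset.sum_mul, Finset.sum_add_distrib, sum_quadraticChar_sq,
      quadraticChar_sum_zero hringChar, add_zero]
  have hp1 : ((p : ℤ) - 1) ≠ 0 := by have := hpp.two_le; omega
  have h3 : 2 * ((p : ℤ) * E.card) = p ^ Module.finrank (ZMod p) V :=
    mul_left_cancel₀ hp1 (by linear_combination h2)
  have h4 : Odd ((p : ℤ) ^ Module.finrank (ZMod p) V) := hodd.pow
  rw [← h3] at h4
  exact (Int.not_odd_iff_even.2 (even_two_mul _)) h4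

/-- For j₀ ≠ 0 one gets p N_0 = p^n - e p^k, an even number, against the parity of N_0. The odd case
is analogous. -/
theorem eq_zero_of_walsh_zero_even (hp : p ≠ 2) (B : LinearMap.BilinForm (ZMod p) V)
    (h : IsScalarTransversal (p := p) (Dsq f) E) (h' : IsScalarTransversal (p := p) (Dnsq f) E')
    {k : ℕ} {e : ℤ} (he : e = 1 ∨ e = -1) {j₀ : ZMod p}
    (hw : walsh B f 0 = e * (mu p (2 * k) * (halfPow p (2 * k) : ℂ) * ZMod.stdAddChar j₀)) :
    j₀ = 0 := by
  by_contra hj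
  have hodd : Odd (p : ℤ) := by exact_mod_cast (Fact.out : p.Prime).odd_of_ne_two hp
  have h1 := valueCount_even hp B f hw 0
  rw [if_neg (Ne.symm hj), card_eq_pow_finrank_zmod (p := p)] at h1
  have h2 : Odd ((p : ℤ) * valueCount f 0) := hodd.mul (odd_valueCount_zero hp h h')
  have h3 : Odd (e * (p : ℤ) ^ k) :=
    Odd.mul (by rcases he with rfl | rfl <;> decide) hodd.pow
  rw [h1, add_zero] at h2
  exact (Int.not_odd_iff_even.2 ((hodd.pow).sub_odd h3)) h2

theorem eq_zero_of_walsh_zero_odd (hp : p ≠ 2) (B : LinearMap.BilinForm (ZMod p) V)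
    (h : IsScalarTransversal (p := p) (Dsq f) E) (h' : IsScalarTransversal (p := p) (Dnsq f) E')
    {k : ℕ} {e : ℤ} (he : e = 1 ∨ e = -1) {j₀ : ZMod p}
    (hw : walsh B f 0 =
      e * (mu p (2 * k + 1) * (halfPow p (2 * k + 1) : ℂ) * ZMod.stdAddChar j₀)) :
    j₀ = 0 := by
  by_contra hj
  have hodd : Odd (p : ℤ) := by exact_mod_cast (Fact.out : p.Prime).odd_of_ne_two hp
  have h1 := valueCount_odd hp B f hw 0
  rw [card_eq_pow_finrank_zmod (p := p)] at h1
  have h2 : Odd ((p : ℤ) * valueCount f 0) := hodd.mul (odd_valueCount_zero hp h h')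
  have h3 : Odd ((p : ℤ) * (e * (p : ℤ) ^ k * quadraticChar (ZMod p) (0 - j₀))) := by
    refine hodd.mul (Odd.mul (Odd.mul (by rcases he with rfl | rfl <;> decide) hodd.pow) ?_)
    rcases quadraticChar_dichotomy (sub_ne_zero.2 (Ne.symm hj)) with h | h <;> rw [h] <;> decide
  rw [h1] at h2
  exact (Int.not_odd_iff_even.2 ((hodd.pow).add_odd h3)) h2

theorem card_transversal_even (hp : p ≠ 2) (B : LinearMap.BilinForm (ZMod p) V)
    (h : IsScalarTransversal (p := p) (Dsq f) E) (h' : IsScalarTransversal (p := p) (Dnsq f) E')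
    {k : ℕ} {e : ℤ}
    (hw : walsh B f 0 = e * (mu p (2 * k) * (halfPow p (2 * k) : ℂ) * ZMod.stdAddChar (0 : ZMod p))) :
    2 * ((p : ℤ) * E.card) = p ^ Module.finrank (ZMod p) V - e * p ^ k ∧
      2 * ((p : ℤ) * E'.card) = p ^ Module.finrank (ZMod p) V - e * p ^ k := by
  have hpp : p.Prime := Fact.out
  have hringChar : ringChar (ZMod p) ≠ 2 := by rwa [ZMod.ringChar_zmod_n]
  have h1 := valueCount_even hp B f hw
  rw [card_eq_pow_finrank_zmod (p := p)] at h1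
  have hp1 : ((p : ℤ) - 1) ≠ 0 := by have := hpp.two_le; omega
  -- c = 1 treats the squares and c = -1 the nonsquares. The deviating count at j = 0 has weight
  -- zero.
  have key : ∀ c : ℤ, (p : ℤ) *
      ∑ j, (quadraticChar (ZMod p) j ^ 2 + c * quadraticChar (ZMod p) j) * valueCount f j =
      ((p : ℤ) - 1) * (p ^ Module.finrank (ZMod p) V - e * p ^ k) := by
    intro c
    rw [Finset.mul_sum, Finset.sum_congr rfl (g := fun j =>
      (quadraticChar (ZMod p) j ^ 2 + c * quadraticChar (ZMod p) j) *
        ((p : ℤ) ^ Module.finrank (ZMod p) V - e * p ^ k)),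
      ← Finset.sum_mul, Finset.sum_add_distrib, ← Finset.mul_sum, sum_quadraticChar_sq,
      quadraticChar_sum_zero hringChar, mul_zero, add_zero]
    intro j _
    rw [mul_left_comm, h1 j]
    split_ifs with hj
    · simp [hj]
    · rw [add_zero]
  have h2 := key 1
  have h3 := key (-1)
  simp only [one_mul, neg_one_mul, ← sub_eq_add_neg] at h2 h3
  rw [← h.two_mul_card_sq] at h2
  rw [← h'.two_mul_card_nsq] at h3
  exact ⟨mul_left_cancel₀ hp1 (by linear_combination h2),
    mul_left_cancel₀ hp1 (by linear_combination h3)⟩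

theorem card_transversal_odd (hp : p ≠ 2) (B : LinearMap.BilinForm (ZMod p) V)
    (h : IsScalarTransversal (p := p) (Dsq f) E) (h' : IsScalarTransversal (p := p) (Dnsq f) E')
    {k : ℕ} {e : ℤ}
    (hw : walsh B f 0 =
      e * (mu p (2 * k + 1) * (halfPow p (2 * k + 1) : ℂ) * ZMod.stdAddChar (0 : ZMod p))) :
    2 * ((p : ℤ) * E.card) = p ^ Module.finrank (ZMod p) V + p * (e * p ^ k) ∧
      2 * ((p : ℤ) * E'.card) = p ^ Module.finrank (ZMod p) V - p * (e * p ^ k) := by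
  have hpp : p.Prime := Fact.out
  have hringChar : ringChar (ZMod p) ≠ 2 := by rwa [ZMod.ringChar_zmod_n]
  have h1 := valueCount_odd hp B f hw
  simp only [sub_zero] at h1
  rw [card_eq_pow_finrank_zmod (p := p)] at h1
  have hp1 : ((p : ℤ) - 1) ≠ 0 := by have := hpp.two_le; omega
  have key : ∀ c : ℤ, (p : ℤ) *
      ∑ j, (quadraticChar (ZMod p) j ^ 2 + c * quadraticChar (ZMod p) j) * valueCount f j =
      ((p : ℤ) - 1) * (p ^ Module.finrank (ZMod p) V + c * (p * (e * p ^ k))) := by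
    intro c
    -- By χ³ = χ, the product (χ² + cχ)(A + Cχ) is (A + cC)χ² + (cA + C)χ, and χ sums to zero.
    rw [Finset.mul_sum, Finset.sum_congr rfl (g := fun j =>
      quadraticChar (ZMod p) j ^ 2 *
        ((p : ℤ) ^ Module.finrank (ZMod p) V + c * (p * (e * p ^ k))) +
      quadraticChar (ZMod p) j *
        (c * (p : ℤ) ^ Module.finrank (ZMod p) V + p * (e * p ^ k))),
      Finset.sum_add_distrib, ← Finset.sum_mul, ← Finset.sum_mul, sum_quadraticChar_sq,
      quadraticChar_sum_zero hringChar, zero_mul, add_zero]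
    intro j _
    rw [mul_left_comm, h1 j]
    linear_combination (p * (e * (p : ℤ) ^ k)) * quadraticChar_pow_three j
  have h2 := key 1
  have h3 := key (-1)
  simp only [one_mul, neg_one_mul, ← sub_eq_add_neg] at h2 h3
  rw [← h.two_mul_card_sq] at h2
  rw [← h'.two_mul_card_nsq] at h3
  exact ⟨mul_left_cancel₀ hp1 (by linear_combination h2),
    mul_left_cancel₀ hp1 (by linear_combination h3)⟩

end Counting

end PlateauedCode

namespace PlateauedCode

/-! ### Dimension and minimum distance of the dual code. -/

section Codes

variable {p : ℕ} [Fact p.Prime] {V : Type*} [AddCommGroup V] [Module (ZMod p) V]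
  {B : LinearMap.BilinForm (ZMod p) V} {E : Finset V} {D : Set V}

theorem eq_zero_of_forall_bilin_eq_zero (hB : B.Nondegenerate) {v : V} (h : ∀ a, B a v = 0) :
    v = 0 := hB.2 v h

/-- The dual of a defining set code consists of the linear relations on the defining set. -/
theorem dualCode_definingSetCode (hB : B.Nondegenerate) :
    dualCode (definingSetCode B E) =
      LinearMap.ker (Fintype.linearCombination (ZMod p) (fun x : E => (x : V))) := by
  ext v
  have key : ∀ a, ∑ i, v i * B a (i : V) = B a (∑ i, v i • (i : V)) := by
    intro a; simp
  rw [LinearMap.mem_ker, Fintype.linearCombination_apply]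
  constructor
  · intro h
    refine eq_zero_of_forall_bilin_eq_zero hB fun a => ?_
    rw [← key a]
    exact h _ ⟨a, rfl⟩
  · rintro h _ ⟨a, rfl⟩
    change ∑ i, v i * B a (i : V) = 0
    rw [key a, h, map_zero]

/-- Rank-nullity for the map sending coefficients to linear combinations of E. If it were not onto,
a nonzero functional, represented through `B`, would vanish on E. -/
theorem finrank_dualCode [Fintype V] (hB : B.Nondegenerate)
    (hspan : ∀ a, a ≠ 0 → ∃ x ∈ E, B a x ≠ 0) :
    Module.finrank (ZMod p) (dualCode (definingSetCode B E)) + Module.finrank (ZMod p) V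
      = E.card := by
  classical
  have : Module.Finite (ZMod p) V := Module.Finite.of_finite
  set L := Fintype.linearCombination (ZMod p) (fun x : E => (x : V))
  have hL : LinearMap.range L = ⊤ := by
    by_contra hne
    obtain ⟨g, hg, hle⟩ := Submodule.exists_le_ker_of_lt_top _ (lt_top_iff_ne_top.2 hne)
    let a := (B.toDual hB).symm g
    have hga : ∀ x, B a x = g x := fun x => by
      rw [← LinearMap.BilinForm.toDual_def hB]; simp [a]
    have ha : a ≠ 0 := by
      intro h0; apply hg; ext x; rw [← hga x, h0]; simp
    obtain ⟨x, hx, hx0⟩ := hspan a ha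
    refine hx0 ?_
    rw [hga]
    refine hle ⟨Pi.single ⟨x, hx⟩ 1, ?_⟩
    simp [L]
  have h := LinearMap.finrank_range_add_finrank_ker L
  rw [hL, finrank_top, Module.finrank_fintype_fun_eq_card, Fintype.card_coe] at h
  rw [dualCode_definingSetCode hB, ← h, add_comm]

/-- A relation of weight 1 would put 0 in E, and one of weight 2 would make two vectors of E
proportional. -/
theorem three_le_hammingNorm (hp : p ≠ 2) (hE : IsScalarTransversal (p := p) D E)
    {v : E → ZMod p} (hv : ∑ i, v i • (i : V) = 0) (hv0 : v ≠ 0) : 3 ≤ hammingNorm v := by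
  classical
  by_contra hlt
  have hsum : ∑ i ∈ Finset.univ.filter (fun i => v i ≠ 0), v i • (i : V) = 0 := by
    rw [← hv]
    refine Finset.sum_subset (Finset.subset_univ _) fun i _ hi => ?_
    have : v i = 0 := by simpa using hi
    rw [this, zero_smul]
  have hcard : (Finset.univ.filter (fun i => v i ≠ 0)).card = hammingNorm v := rfl
  have hmem : ∀ i ∈ Finset.univ.filter (fun i => v i ≠ 0), v i ≠ 0 := fun i hi =>
    (Finset.mem_filter.1 hi).2
  generalize Finset.univ.filter (fun i => v i ≠ 0) = T at hsum hcard hmem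
  have h3 : T.card = 0 ∨ T.card = 1 ∨ T.card = 2 := by omega
  rcases h3 with h | h | h
  · rw [h] at hcard
    exact hv0 (hammingNorm_eq_zero.1 hcard.symm)
  · obtain ⟨i, rfl⟩ := Finset.card_eq_one.1 h
    rw [Finset.sum_singleton] at hsum
    rcases smul_eq_zero.1 hsum with h | h
    · exact hmem i (Finset.mem_singleton_self i) h
    · exact hE.ne_zero hp (hE.subset i.2) h
  · obtain ⟨i, j, hij, rfl⟩ := Finset.card_eq_two.1 h
    rw [Finset.sum_pair hij] at hsum
    have hi := hmem i (by simp)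
    have hj := hmem j (by simp)
    refine hij (Subtype.ext (hE.eq_of_smul_eq i.2 j.2 (a := Units.mk0 _ hi)
      (b := -Units.mk0 _ hj) ?_))
    simpa using eq_neg_of_add_eq_zero_left hsum

/-- The dual code of a scalar transversal of `D` has minimum distance `3` as soon as `D` contains
three pairwise independent vectors with sum zero. -/
theorem hasMinDist_three (hp : p ≠ 2) (hB : B.Nondegenerate)
    (hE : IsScalarTransversal (p := p) D E)
    (h : ∃ x ∈ D, ∃ y ∈ D, ∃ z ∈ D, x + y + z = 0 ∧ ∀ c : ZMod p, y ≠ c • x) :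
    HasMinDist (dualCode (definingSetCode B E)) 3 := by
  classical
  have hmem : ∀ v, v ∈ dualCode (definingSetCode B E) ↔ ∑ i, v i • (i : V) = 0 := by
    intro v
    rw [dualCode_definingSetCode hB, LinearMap.mem_ker, Fintype.linearCombination_apply]
  constructor
  · obtain ⟨x, hx, y, hy, z, hz, hxyz, hyx⟩ := h
    obtain ⟨a, x', hx', rfl⟩ := hE.exists_smul hx
    obtain ⟨b, y', hy', rfl⟩ := hE.exists_smul hy
    obtain ⟨c, z', hz', rfl⟩ := hE.exists_smul hz
    -- It suffices that x' differs from y' and z': then `v` is nonzero at x', and the general lower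
    -- bound yields weight 3.
    have hxy : x' ≠ y' := by
      rintro rfl
      refine hyx (b * (a : ZMod p)⁻¹) ?_
      rw [smul_smul, mul_assoc, inv_mul_cancel₀ a.ne_zero, mul_one]
    have hxz : x' ≠ z' := by
      rintro rfl
      refine hyx (-((a : ZMod p) + c) * (a : ZMod p)⁻¹) ?_
      rw [smul_smul, mul_assoc, inv_mul_cancel₀ a.ne_zero, mul_one, neg_smul, add_smul,
        eq_neg_iff_add_eq_zero, ← hxyz]
      abel
    let v : E → ZMod p := Pi.single ⟨x', hx'⟩ (a : ZMod p) + Pi.single ⟨y', hy'⟩ (b : ZMod p)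
      + Pi.single ⟨z', hz'⟩ (c : ZMod p)
    have hv : ∑ i, v i • (i : V) = 0 := by
      rw [← hxyz, ← Fintype.linearCombination_apply (ZMod p) (fun i : E => (i : V)) v]
      simp only [v, map_add, Fintype.linearCombination_apply_single]
    have hv0 : v ≠ 0 := by
      intro h0
      have := congrFun h0 ⟨x', hx'⟩
      simp [v, hxy, hxz] at this
    have hle : hammingNorm v ≤ 3 := by
      refine (Finset.card_le_card (t := {⟨x', hx'⟩, ⟨y', hy'⟩, ⟨z', hz'⟩}) ?_).trans
        Finset.card_le_three
      intro i hi
      have hi := (Finset.mem_filter.1 hi).2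
      by_contra hni
      simp only [Finset.mem_insert, Finset.mem_singleton, not_or] at hni
      exact hi (by simp [v, hni])
    refine ⟨v, (hmem v).2 hv, 0, Submodule.zero_mem _, hv0, ?_⟩
    rw [hammingDist_zero_right]
    exact le_antisymm hle (three_le_hammingNorm hp hE hv hv0)
  · rintro m ⟨v, hv, w, hw, hne, rfl⟩
    rw [hammingDist_eq_hammingNorm]
    refine three_le_hammingNorm hp hE ((hmem _).1 ?_) fun h0 => hne (neg_add_eq_zero.1 h0)
    rw [← sub_eq_neg_add]
    exact Submodule.sub_mem _ hw hv

theorem not_hasMinDist_of_finrank_eq_zero {ι : Type*} [Fintype ι]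
    {C : Submodule (ZMod p) (ι → ZMod p)} (h : Module.finrank (ZMod p) C = 0) (d : ℕ) :
    ¬ HasMinDist C d := by
  rintro ⟨⟨x, hx, y, hy, hne, -⟩, -⟩
  rw [Submodule.finrank_eq_zero] at h
  subst h
  rw [Submodule.mem_bot] at hx hy
  exact hne (hx.trans hy.symm)

end Codes

end PlateauedCode

namespace PlateauedCode

/-! ### Fourier transforms of level sets. -/

section Fourier

variable {p : ℕ} [Fact p.Prime] {V : Type*} [AddCommGroup V] [Module (ZMod p) V] [Fintype V]
  {B : LinearMap.BilinForm (ZMod p) V}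

/-- The sum is the conjugate under ξ ↦ ξ^z of W_f(-z⁻¹β), whose squared modulus is rational and
hence preserved. -/
theorem norm_walsh_le {f : V → ZMod p} {m : ℕ}
    (hf : ∀ α, ‖walsh B f α‖ = 0 ∨ ‖walsh B f α‖ = halfPow p m) {z : ZMod p} (hz : z ≠ 0) (β : V) :
    ‖∑ x, (ZMod.stdAddChar (z * f x + B β x) : ℂ)‖ ≤ halfPow p m := by
  have h1 : ∀ x, z * f x + B β x = z * (f x - B (-(z⁻¹ • β)) x) := by
    intro x
    simp only [map_neg, map_smul, LinearMap.neg_apply, LinearMap.smul_apply, smul_eq_mul]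
    field_simp
    ring
  set α := -(z⁻¹ • β)
  let c : ZMod p → ℚ := fun j => ((Finset.univ.filter (fun x => f x - B α x = j)).card : ℚ)
  have h2 : ∀ y : ZMod p, ∑ x, (ZMod.stdAddChar (y * (f x - B α x)) : ℂ)
      = ∑ j, (c j : ℂ) * ZMod.stdAddChar (y * j) := by
    intro y
    rw [← Finset.sum_fiberwise Finset.univ (fun x => f x - B α x)]
    refine Finset.sum_congr rfl fun j _ => ?_
    rw [Finset.sum_congr rfl (g := fun _ => (ZMod.stdAddChar (y * j) : ℂ)), Finset.sum_const,
      nsmul_eq_mul]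
    · simp [c]
    · intro x hx
      rw [(Finset.mem_filter.1 hx).2]
  have h3 : walsh B f α = ∑ j, (c j : ℂ) * ZMod.stdAddChar j := by
    have := h2 1
    simp only [one_mul] at this
    rw [← this]; rfl
  obtain ⟨P, hP, hPle⟩ : ∃ P : ℚ, ‖walsh B f α‖ ^ 2 = P ∧ (P : ℝ) ≤ halfPow p m ^ 2 := by
    rcases hf α with h | h
    · exact ⟨0, by rw [h]; simp, by simpa using sq_nonneg _⟩
    · refine ⟨(p : ℚ) ^ m, by rw [h, halfPow_sq]; simp, ?_⟩
      rw [halfPow_sq]; simp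
  rw [h3] at hP
  have h4 := norm_sq_sum_stdAddChar_mul c P hP hz
  rw [← h2] at h4
  simp only [h1]
  refine le_of_sq_le_sq ?_ (halfPow_pos m).le
  rw [h4]; exact hPle

theorem sum_stdAddChar_bilin (hB : B.Nondegenerate) {β : V} (hβ : β ≠ 0) :
    ∑ x, (ZMod.stdAddChar (B β x) : ℂ) = 0 := by
  let χ : AddChar V ℂ := (ZMod.stdAddChar (N := p)).compAddMonoidHom (B β).toAddMonoidHom
  have hχ : χ ≠ 1 := by
    intro h
    apply hβ
    refine hB.1 β fun x => ?_
    have h1 : χ x = 1 := by rw [h]; rfl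
    change ZMod.stdAddChar (B β x) = 1 at h1
    rw [← (ZMod.stdAddChar (N := p)).map_zero_eq_one] at h1
    exact ZMod.injective_stdAddChar h1
  exact AddChar.sum_eq_zero_of_ne_one hχ

/-- The Fourier transform of the indicator function of a finite set. -/
noncomputable def indicatorTransform (B : LinearMap.BilinForm (ZMod p) V) (D : Finset V) (β : V) : ℂ :=
  ∑ x ∈ D, ZMod.stdAddChar (B β x)

theorem mul_indicatorTransform (f : V → ZMod p) (j : ZMod p) (β : V) :
    (p : ℂ) * indicatorTransform B (Finset.univ.filter (fun x => f x = j)) β =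
      ∑ z : ZMod p, ZMod.stdAddChar (-(z * j)) * ∑ x, ZMod.stdAddChar (z * f x + B β x) := by
  classical
  simp only [Finset.mul_sum]
  rw [Finset.sum_comm, indicatorTransform, Finset.sum_filter, Finset.mul_sum]
  refine Finset.sum_congr rfl fun x _ => ?_
  have h1 : ∀ z : ZMod p, (ZMod.stdAddChar (-(z * j)) : ℂ) * ZMod.stdAddChar (z * f x + B β x)
      = ZMod.stdAddChar (z * (f x - j)) * ZMod.stdAddChar (B β x) := by
    intro z
    rw [← AddChar.map_add_eq_mul, ← AddChar.map_add_eq_mul]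
    congr 1; ring
  rw [Finset.sum_congr rfl fun z _ => h1 z, ← Finset.sum_mul,
    AddChar.sum_mulShift _ (ZMod.isPrimitive_stdAddChar p), ZMod.card]
  by_cases h : f x = j
  · simp [h]
  · simp [h, sub_eq_zero]

/-- When f = j is detected by additive characters, the trivial one contributes nothing at β ≠ 0, and
the other p - 1 are bounded by the plateau value. -/
theorem norm_indicatorTransform_le (hB : B.Nondegenerate) {f : V → ZMod p} {m : ℕ}
    (hf : ∀ α, ‖walsh B f α‖ = 0 ∨ ‖walsh B f α‖ = halfPow p m) (j : ZMod p) {β : V} (hβ : β ≠ 0) :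
    p * ‖indicatorTransform B (Finset.univ.filter (fun x => f x = j)) β‖ ≤
      (p - 1) * halfPow p m := by
  classical
  have h1 : (p : ℝ) * ‖indicatorTransform B (Finset.univ.filter (fun x => f x = j)) β‖ =
      ‖(p : ℂ) * indicatorTransform B (Finset.univ.filter (fun x => f x = j)) β‖ := by
    rw [norm_mul, Complex.norm_natCast]
  rw [h1, mul_indicatorTransform, ← Finset.sum_erase_add _ _ (Finset.mem_univ (0 : ZMod p))]
  simp only [zero_mul, zero_add, sum_stdAddChar_bilin hB hβ, mul_zero, add_zero]
  refine (norm_sum_le _ _).trans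
    ((Finset.sum_le_sum (g := fun _ => halfPow p m) fun z hz => ?_).trans ?_)
  · rw [norm_mul, norm_stdAddChar, one_mul]
    exact norm_walsh_le hf (Finset.ne_of_mem_erase hz) β
  · rw [Finset.sum_const, Finset.card_erase_of_mem (Finset.mem_univ _), Finset.card_univ,
      ZMod.card, nsmul_eq_mul, Nat.cast_sub (Fact.out : p.Prime).one_le, Nat.cast_one]

/-- Large level sets are not contained in a hyperplane. -/
theorem exists_bilin_ne_zero (hB : B.Nondegenerate) {f : V → ZMod p} {m : ℕ}
    (hf : ∀ α, ‖walsh B f α‖ = 0 ∨ ‖walsh B f α‖ = halfPow p m) (j : ZMod p)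
    (hj : (p - 1) * halfPow p m < p * valueCount f j) {β : V} (hβ : β ≠ 0) :
    ∃ x, f x = j ∧ B β x ≠ 0 := by
  by_contra hcon
  push Not at hcon
  have h1 : indicatorTransform B (Finset.univ.filter (fun x => f x = j)) β = valueCount f j := by
    rw [indicatorTransform, Finset.sum_congr rfl (g := fun _ => 1), Finset.sum_const]
    · simp [valueCount]
    · intro x hx
      rw [hcon x (Finset.mem_filter.1 hx).2, AddChar.map_zero_eq_one]
  have h2 := norm_indicatorTransform_le hB hf j hβ
  rw [h1, Complex.norm_natCast] at h2
  linarith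

/-- The number of zero-sum `k`-tuples of `D` is the `k`-th moment of the transform. -/
theorem sum_indicatorTransform_pow (hB : B.Nondegenerate) [DecidableEq V] (D : Finset V) (k : ℕ) :
    ∑ β, indicatorTransform B D β ^ k = (Fintype.card V : ℂ) *
      ((Fintype.piFinset (fun _ : Fin k => D)).filter (fun x => ∑ i, x i = 0)).card := by
  have h1 : ∀ β, indicatorTransform B D β ^ k =
      ∑ x ∈ Fintype.piFinset (fun _ : Fin k => D), ZMod.stdAddChar (B β (∑ i, x i)) := by
    intro β
    rw [indicatorTransform, Finset.sum_pow']
    refine Finset.sum_congr rfl fun x _ => ?_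
    rw [map_sum]
    exact (map_prod (ZMod.stdAddChar (N := p)).toMonoidHom
      (fun i => Multiplicative.ofAdd (B β (x i))) Finset.univ).symm
  simp only [h1]
  rw [Finset.sum_comm, Finset.card_filter]
  push_cast
  rw [Finset.mul_sum]
  refine Finset.sum_congr rfl fun x _ => ?_
  by_cases hx : ∑ i, x i = 0
  · simp [hx]
  · rw [if_neg hx, mul_zero]
    have hflip : (LinearMap.flip B).Nondegenerate := ⟨hB.2, hB.1⟩
    exact sum_stdAddChar_bilin hflip hx

end Fourier

end PlateauedCode

namespace PlateauedCode

/-! ### Existence of independent zero-sum triples. -/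

section Triples

theorem zmod_three_cases (c : ZMod 3) : c = 0 ∨ c = 1 ∨ c = 2 := by
  revert c; decide

variable {p : ℕ} [Fact p.Prime] {V : Type*} [AddCommGroup V] [Module (ZMod p) V]

/-- A large scalar-closed set contains three pairwise independent vectors with sum zero. -/
theorem exists_zero_sum_triple_of_card [Fintype V] {F : Finset V} (h0 : (0 : V) ∉ F)
    (hsmul : ∀ x ∈ F, ∀ a : ZMod p, a ≠ 0 → a • x ∈ F)
    (hcard : Fintype.card V + p * (p - 2) < p * F.card) :
    ∃ x ∈ F, ∃ y ∈ F, ∃ z ∈ F, x + y + z = 0 ∧ ∀ c : ZMod p, y ≠ c • x := by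
  classical
  have hpp : p.Prime := Fact.out
  by_contra hcon
  push Not at hcon
  obtain ⟨x, hx⟩ : F.Nonempty := by
    rw [Finset.nonempty_iff_ne_empty]; rintro rfl; simp at hcard
  have hx0 : x ≠ 0 := fun h => h0 (h ▸ hx)
  let S : Finset V := Finset.univ.image (fun c : ZMod p => c • x)
  have hS : S.card = p := by
    rw [Finset.card_image_of_injective _ (smul_left_injective (ZMod p) hx0), Finset.card_univ,
      ZMod.card]
  have hmemS : ∀ y, y ∈ S ↔ ∃ c : ZMod p, c • x = y := fun y => by simp [S]
  let A := F \ S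
  have hA : F.card ≤ A.card + (p - 1) := by
    have h1 : (F ∩ S).card ≤ (S.erase 0).card := by
      refine Finset.card_le_card fun y hy => ?_
      rw [Finset.mem_inter] at hy
      exact Finset.mem_erase.2 ⟨fun h => h0 (h ▸ hy.1), hy.2⟩
    rw [Finset.card_erase_of_mem ((hmemS 0).2 ⟨0, zero_smul _ _⟩), hS] at h1
    have h2 := Finset.card_sdiff_add_card_inter F S
    simp only [A]
    omega
  -- Let A be the part of F off the line S through x. A coincidence y + cx = y' + c'x with c ≠ c' is
  -- a zero-sum triple (c - c')x, y, -y' in F. Without such triples the p|A| vectors y + cx are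
  -- distinct and avoid S, so p(|F| - (p - 1)) ≤ |V| - p.
  have hinj : (A ×ˢ (Finset.univ : Finset (ZMod p))).card ≤ (Finset.univ \ S).card := by
    refine Finset.card_le_card_of_injOn (fun q => q.1 + q.2 • x) ?_ ?_
    · rintro ⟨y, c⟩ hy
      have hy := (Finset.mem_product.1 (Finset.mem_coe.1 hy)).1
      refine Finset.mem_coe.2 (Finset.mem_sdiff.2 ⟨Finset.mem_univ _, fun h => ?_⟩)
      obtain ⟨d, hd⟩ := (hmemS _).1 h
      refine (Finset.mem_sdiff.1 hy).2 ((hmemS y).2 ⟨d - c, ?_⟩)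
      rw [sub_smul, hd, add_sub_cancel_right]
    · rintro ⟨y, c⟩ hy ⟨y', c'⟩ hy' heq
      have hy := Finset.mem_sdiff.1 (Finset.mem_product.1 (Finset.mem_coe.1 hy)).1
      have hy' := Finset.mem_sdiff.1 (Finset.mem_product.1 (Finset.mem_coe.1 hy')).1
      simp only at heq hy hy'
      by_cases hc : c = c'
      · subst hc
        rw [add_right_cancel heq]
      · exfalso
        obtain ⟨d, hd⟩ := hcon ((c - c') • x) (hsmul x hx _ (sub_ne_zero.2 hc)) y hy.1
          ((-1 : ZMod p) • y') (hsmul y' hy'.1 _ (neg_ne_zero.2 one_ne_zero)) (by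
            rw [sub_smul, neg_one_smul]
            refine Eq.trans ?_ (sub_eq_zero.2 heq)
            abel)
        refine hy.2 ((hmemS y).2 ⟨d * (c - c'), ?_⟩)
        rw [hd, smul_smul]
  rw [Finset.card_product, Finset.card_univ, ZMod.card,
    Finset.card_sdiff_of_subset (Finset.subset_univ _), hS, Finset.card_univ] at hinj
  have hp2 := hpp.two_le
  have hV : p ≤ Fintype.card V := hS ▸ Finset.card_le_univ S
  obtain ⟨q, rfl⟩ : ∃ q, p = q + 2 := ⟨p - 2, by omega⟩
  have h3 : (q + 2) * F.card ≤ (q + 2) * (A.card + (q + 1)) := Nat.mul_le_mul_left _ hA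
  have h4 : A.card * (q + 2) + (q + 2) ≤ Fintype.card V := by omega
  simp only [Nat.add_sub_cancel] at hcard
  nlinarith

variable {B : LinearMap.BilinForm (ZMod p) V} {F : Finset V}

theorem indicatorTransform_eq_ofReal (hneg : ∀ x ∈ F, -x ∈ F) (β : V) :
    indicatorTransform B F β = ((indicatorTransform B F β).re : ℂ) := by
  refine (Complex.conj_eq_iff_re.1 ?_).symm
  rw [indicatorTransform, map_sum]
  refine Finset.sum_nbij' (fun x => -x) (fun x => -x) hneg hneg (by simp) (by simp) ?_
  intro x _
  rw [conj_stdAddChar, map_neg (B β)]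

theorem indicatorTransform_zero : indicatorTransform B F 0 = F.card := by
  simp [indicatorTransform]

theorem card_zero_sum_one [DecidableEq V] (h0 : (0 : V) ∉ F) :
    ((Fintype.piFinset (fun _ : Fin 1 => F)).filter (fun x => ∑ i, x i = 0)).card = 0 := by
  rw [Finset.card_eq_zero, Finset.filter_eq_empty_iff]
  intro x hx h
  rw [Fin.sum_univ_one] at h
  exact h0 (h ▸ Fintype.mem_piFinset.1 hx 0)

theorem card_zero_sum_two [DecidableEq V] (hneg : ∀ x ∈ F, -x ∈ F) :
    ((Fintype.piFinset (fun _ : Fin 2 => F)).filter (fun x => ∑ i, x i = 0)).card = F.card := by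
  refine Finset.card_nbij' (fun x => x 0) (fun y => ![y, -y]) ?_ ?_ ?_ ?_
  · intro x hx
    exact Fintype.mem_piFinset.1 (Finset.mem_filter.1 hx).1 0
  · intro y hy
    refine Finset.mem_filter.2 ⟨Fintype.mem_piFinset.2 fun i => ?_, by simp⟩
    fin_cases i
    · exact hy
    · exact hneg y hy
  · intro x hx
    have h := (Finset.mem_filter.1 hx).2
    rw [Fin.sum_univ_two] at h
    funext i
    fin_cases i
    · rfl
    · exact neg_eq_of_add_eq_zero_right h
  · intro y _
    rfl

/-- If y = cx over F_3, then c = 0 gives y = 0 and c = 2 gives z = 0, both excluded. So c = 1, and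
the only zero-sum triples are (x, x, x). -/
theorem card_zero_sum_three_le [DecidableEq V] (hp : p = 3) (h0 : (0 : V) ∉ F)
    (hcon : ¬ ∃ x ∈ F, ∃ y ∈ F, ∃ z ∈ F, x + y + z = 0 ∧ ∀ c : ZMod p, y ≠ c • x) :
    ((Fintype.piFinset (fun _ : Fin 3 => F)).filter (fun x => ∑ i, x i = 0)).card ≤ F.card := by
  subst hp
  push Not at hcon
  have key : ∀ x ∈ (Fintype.piFinset (fun _ : Fin 3 => F)).filter (fun x => ∑ i, x i = 0),
      x 1 = x 0 ∧ x 2 = x 0 := by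
    intro x hx
    obtain ⟨hx, hs⟩ := Finset.mem_filter.1 hx
    have hx := Fintype.mem_piFinset.1 hx
    rw [Fin.sum_univ_three] at hs
    obtain ⟨c, hc⟩ := hcon (x 0) (hx 0) (x 1) (hx 1) (x 2) (hx 2) hs
    have h3 : (3 : ZMod 3) • x 0 = 0 := by
      rw [show (3 : ZMod 3) = 0 from rfl, zero_smul]
    have hc3 : c = 0 ∨ c = 1 ∨ c = 2 := zmod_three_cases c
    rcases hc3 with rfl | rfl | rfl
    · rw [zero_smul] at hc
      exact absurd (hx 1) (hc ▸ h0)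
    · rw [one_smul] at hc
      refine ⟨hc, ?_⟩
      rw [hc] at hs
      have h4 : x 0 + x 0 + x 0 = 0 := by
        rw [← h3]; module
      exact add_left_cancel (hs.trans h4.symm)
    · have h4 : x 0 + x 1 = 0 := by
        rw [← h3, hc]; module
      rw [h4, zero_add] at hs
      exact absurd (hx 2) (hs ▸ h0)
  refine Finset.card_le_card_of_injOn (fun x => x 0) ?_ ?_
  · intro x hx
    exact Fintype.mem_piFinset.1 (Finset.mem_filter.1 hx).1 0
  · intro x hx y hy hxy
    have h1 := key x hx
    have h2 := key y hy
    simp only at hxy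
    funext i
    fin_cases i
    · exact hxy
    · exact h1.1.trans (hxy.trans h2.1.symm)
    · exact h1.2.trans (hxy.trans h2.2.symm)

/-- The third moment of the Fourier transform detects non-degenerate zero-sum triples over `F_3`. -/
theorem exists_zero_sum_triple_of_third_moment [Fintype V] (hp : p = 3) (hB : B.Nondegenerate)
    (h0 : (0 : V) ∉ F) (hne : F.Nonempty) (hneg : ∀ x ∈ F, -x ∈ F) (u v : ℝ)
    (huv : ∀ β, β ≠ 0 → u * (indicatorTransform B F β).re ^ 2 + v * (indicatorTransform B F β).re ≤
      (indicatorTransform B F β).re ^ 3)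
    (hlt : (Fintype.card V : ℝ) <
      (F.card : ℝ) ^ 2 + u * ((Fintype.card V : ℝ) - F.card) - v) :
    ∃ x ∈ F, ∃ y ∈ F, ∃ z ∈ F, x + y + z = 0 ∧ ∀ c : ZMod p, y ≠ c • x := by
  classical
  by_contra hcon
  -- The transform of a symmetric set is real. Its first three moments, divided by |V|, are 0, |F|
  -- and at most |F|.
  have hmom : ∀ k : ℕ, ∑ β, (indicatorTransform B F β).re ^ k = (Fintype.card V : ℝ) *
      ((Fintype.piFinset (fun _ : Fin k => F)).filter (fun x => ∑ i, x i = 0)).card := by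
    intro k
    have h := sum_indicatorTransform_pow hB F k
    rw [Finset.sum_congr rfl fun β _ => by rw [indicatorTransform_eq_ofReal hneg β]] at h
    exact_mod_cast h
  have h1 := hmom 1
  have h2 := hmom 2
  have h3 := hmom 3
  rw [card_zero_sum_one h0, Nat.cast_zero, mul_zero] at h1
  rw [card_zero_sum_two hneg] at h2
  simp only [pow_one] at h1
  have hT : (((Fintype.piFinset (fun _ : Fin 3 => F)).filter (fun x => ∑ i, x i = 0)).card : ℝ) ≤
      F.card := by exact_mod_cast card_zero_sum_three_le hp h0 hcon
  rw [← Finset.sum_erase_add _ _ (Finset.mem_univ (0 : V)), indicatorTransform_zero,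
    Complex.natCast_re] at h1 h2 h3
  -- Summing the cubic inequality over β ≠ 0 and dividing by |F| gives the reverse of `hlt`.
  have hsum := Finset.sum_le_sum (s := Finset.univ.erase (0 : V)) fun β hβ =>
    huv β (Finset.ne_of_mem_erase hβ)
  rw [Finset.sum_add_distrib, ← Finset.mul_sum, ← Finset.mul_sum] at hsum
  have hF : (0 : ℝ) < F.card := by exact_mod_cast hne.card_pos
  have hV : (0 : ℝ) ≤ Fintype.card V := Nat.cast_nonneg _
  have e1 : ∑ β ∈ Finset.univ.erase (0 : V), (indicatorTransform B F β).re = -F.card := by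
    linarith
  have e2 : ∑ β ∈ Finset.univ.erase (0 : V), (indicatorTransform B F β).re ^ 2 =
      Fintype.card V * F.card - (F.card : ℝ) ^ 2 := by linarith
  rw [e1, e2] at hsum
  have h4 : (Fintype.card V : ℝ) *
      ((Fintype.piFinset (fun _ : Fin 3 => F)).filter (fun x => ∑ i, x i = 0)).card ≤
      Fintype.card V * F.card := mul_le_mul_of_nonneg_left hT hV
  have h5 := mul_lt_mul_of_pos_right hlt hF
  nlinarith

end Triples

end PlateauedCode

namespace PlateauedCode

/-! ### Spanning and zero-sum triples for D_{f,sq} and D_{f,nsq}. -/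

section LevelSets

theorem halfPow_even (p k : ℕ) : halfPow p (2 * k) = (p : ℝ) ^ k := by
  rw [halfPow, pow_mul, Real.sq_sqrt (Nat.cast_nonneg _)]

theorem halfPow_odd (p k : ℕ) : halfPow p (2 * k + 1) = (p : ℝ) ^ k * Real.sqrt p := by
  rw [halfPow, pow_succ, pow_mul, Real.sq_sqrt (Nat.cast_nonneg _)]

theorem zmod_three_eq_one_iff (c : ZMod 3) : c = 1 ↔ c ≠ 0 ∧ IsSquare c := by
  revert c; decide

theorem zmod_three_eq_two_iff (c : ZMod 3) : c = 2 ↔ c ≠ 0 ∧ ¬ IsSquare c := by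
  revert c; decide

/-- Over F_3 the sets D_{f,sq} and D_{f,nsq} are the level sets of 1 and 2. Both are stable under
-1, hence so is the zero set. -/
theorem apply_neg_of_transversals {p : ℕ} [Fact p.Prime] {V : Type*} [AddCommGroup V]
    [Module (ZMod p) V] {f : V → ZMod p} {E E' : Finset V} (hp : p = 3)
    (h : IsScalarTransversal (p := p) (Dsq f) E)
    (h' : IsScalarTransversal (p := p) (Dnsq f) E') (x : V) : f (-x) = f x := by
  subst hp
  have hD : ∀ x, f x = 1 ↔ x ∈ Dsq f := fun x => zmod_three_eq_one_iff (f x)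
  have hD' : ∀ x, f x = 2 ↔ x ∈ Dnsq f := fun x => zmod_three_eq_two_iff (f x)
  have key : ∀ x, f x ≠ 0 → f (-x) = f x := by
    intro x hx
    rcases zmod_three_cases (f x) with h0 | h1 | h2
    · exact absurd h0 hx
    · rw [h1, hD, ← neg_one_smul (ZMod 3) x]
      exact h.smul_mem ((hD x).1 h1) (neg_ne_zero.2 one_ne_zero)
    · rw [h2, hD', ← neg_one_smul (ZMod 3) x]
      exact h'.smul_mem ((hD' x).1 h2) (neg_ne_zero.2 one_ne_zero)
  by_cases hx : f x = 0
  · by_contra hne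
    have := key (-x) (by rw [hx] at hne; exact hne)
    rw [neg_neg] at this
    exact hne this.symm
  · exact key x hx

variable {p : ℕ} [Fact p.Prime] {V : Type*} [AddCommGroup V] [Module (ZMod p) V] [Fintype V]
  {B : LinearMap.BilinForm (ZMod p) V} {f : V → ZMod p} {D : Set V} {E E' : Finset V}

theorem exists_bilin_ne_zero_even (hp : p ≠ 2) (hB : B.Nondegenerate) {k n : ℕ}
    (hn : Module.finrank (ZMod p) V = n) (hkn : k + 2 ≤ n)
    (hf : ∀ α, ‖walsh B f α‖ = 0 ∨ ‖walsh B f α‖ = halfPow p (2 * k)) {e : ℤ}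
    (he : e = 1 ∨ e = -1)
    (hw : walsh B f 0 = e * (mu p (2 * k) * (halfPow p (2 * k) : ℂ) * ZMod.stdAddChar (0 : ZMod p)))
    {j : ZMod p} (hj : j ≠ 0) {β : V} (hβ : β ≠ 0) : ∃ x, f x = j ∧ B β x ≠ 0 := by
  refine exists_bilin_ne_zero hB hf j ?_ hβ
  have h1 := valueCount_even hp B f hw j
  rw [if_neg hj, add_zero, card_eq_pow_finrank_zmod (p := p), hn] at h1
  have h2 : (p : ℝ) * valueCount f j = (p : ℝ) ^ n - e * (p : ℝ) ^ k := by exact_mod_cast h1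
  have hp1 : (1 : ℝ) < p := by exact_mod_cast (Fact.out : p.Prime).one_lt
  have hq : (0 : ℝ) < (p : ℝ) ^ k := by positivity
  have h3 : (p : ℝ) ^ (k + 2) ≤ (p : ℝ) ^ n := pow_le_pow_right₀ hp1.le hkn
  rw [h2, halfPow_even]
  have h4 : (e : ℝ) * (p : ℝ) ^ k ≤ (p : ℝ) ^ k := by
    rcases he with rfl | rfl
    · simp
    · push_cast; linarith
  have h5 : (p : ℝ) ^ (k + 2) = (p : ℝ) ^ k * (p * p) := by ring
  have h6 : (p : ℝ) ^ k * p < (p : ℝ) ^ k * (p * p) :=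
    mul_lt_mul_of_pos_left (by nlinarith) hq
  linarith

/-- p N_j ≥ p^(k+2) - p^(k+1) = (p - 1)p^(k+1), which exceeds the Fourier bound (p - 1)p^k √p. -/
theorem exists_bilin_ne_zero_odd (hp : p ≠ 2) (hB : B.Nondegenerate) {k n : ℕ}
    (hn : Module.finrank (ZMod p) V = n) (hkn : k + 2 ≤ n)
    (hf : ∀ α, ‖walsh B f α‖ = 0 ∨ ‖walsh B f α‖ = halfPow p (2 * k + 1)) {e : ℤ}
    (he : e = 1 ∨ e = -1)
    (hw : walsh B f 0 =
      e * (mu p (2 * k + 1) * (halfPow p (2 * k + 1) : ℂ) * ZMod.stdAddChar (0 : ZMod p)))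
    {j : ZMod p} (hj : j ≠ 0) {β : V} (hβ : β ≠ 0) : ∃ x, f x = j ∧ B β x ≠ 0 := by
  refine exists_bilin_ne_zero hB hf j ?_ hβ
  have h1 := valueCount_odd hp B f hw j
  rw [sub_zero, card_eq_pow_finrank_zmod (p := p), hn] at h1
  have h2 : (p : ℝ) * valueCount f j =
      (p : ℝ) ^ n + p * (e * (p : ℝ) ^ k * (quadraticChar (ZMod p) j : ℤ)) := by exact_mod_cast h1
  have hp1 : (1 : ℝ) < p := by exact_mod_cast (Fact.out : p.Prime).one_lt
  have hq : (0 : ℝ) < (p : ℝ) ^ k := by positivity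
  have h3 : (p : ℝ) ^ (k + 2) ≤ (p : ℝ) ^ n := pow_le_pow_right₀ hp1.le hkn
  rw [h2, halfPow_odd]
  have h4 : -(p : ℝ) ^ k ≤ e * (p : ℝ) ^ k * (quadraticChar (ZMod p) j : ℤ) := by
    rcases he with rfl | rfl <;> rcases quadraticChar_dichotomy hj with h | h <;> rw [h] <;>
      push_cast <;> linarith
  have hs : Real.sqrt p < p := by
    rw [Real.sqrt_lt' (by linarith)]; nlinarith
  have h5 : (p : ℝ) ^ (k + 2) = (p : ℝ) ^ k * (p * p) := by ring
  have h6 : (p : ℝ) ^ k * Real.sqrt p < (p : ℝ) ^ k * p := mul_lt_mul_of_pos_left hs hq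
  have h7 := mul_lt_mul_of_pos_left h6 (show (0 : ℝ) < p - 1 by linarith)
  have h8 := mul_le_mul_of_nonneg_left h4 (show (0 : ℝ) ≤ p by linarith)
  linarith

theorem sum_zmod_three {M : Type*} [AddCommMonoid M] (g : ZMod 3 → M) :
    ∑ z, g z = g 0 + g 1 + g 2 := Fin.sum_univ_three g

/-- For even f, three times the transform is ξ^(-j) W_f(β) plus its conjugate. With W_f(β) = ±3^k ·
i√3 · ξ^l this equals ±3^k · i√3 · (ξ^(l-j) - ξ^(j-l)), and the difference is 0 or ±i√3. -/
theorem indicatorTransform_three_odd (hp : p = 3) (hB : B.Nondegenerate) (hfneg : ∀ x, f (-x) = f x)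
    {k : ℕ} (hf : ∀ α, ‖walsh B f α‖ = 0 ∨ ‖walsh B f α‖ = halfPow p (2 * k + 1)) (j : ZMod p)
    {β : V} (hβ : β ≠ 0) :
    indicatorTransform B (Finset.univ.filter (fun x => f x = j)) β = 0 ∨
    indicatorTransform B (Finset.univ.filter (fun x => f x = j)) β = 3 ^ k ∨
    indicatorTransform B (Finset.univ.filter (fun x => f x = j)) β = -3 ^ k := by
  subst hp
  have h1 := mul_indicatorTransform (B := B) f j β
  rw [sum_zmod_three] at h1
  have hpos : ∑ x, (ZMod.stdAddChar (f x + B β x) : ℂ) = walsh B f β := by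
    rw [walsh, walshOn, ← Equiv.sum_comp (Equiv.neg V)]
    refine Finset.sum_congr rfl fun x _ => ?_
    simp only [Equiv.neg_apply, hfneg, map_neg]
    rw [← sub_eq_add_neg]
  have hneg : ∑ x, (ZMod.stdAddChar (2 * f x + B β x) : ℂ) = (starRingEnd ℂ) (walsh B f β) := by
    rw [walsh, walshOn, map_sum]
    refine Finset.sum_congr rfl fun x _ => ?_
    rw [conj_stdAddChar, show (2 : ZMod 3) = -1 from rfl]
    congr 1; ring
  simp only [zero_mul, zero_add, one_mul, sum_stdAddChar_bilin hB hβ, mul_zero, hpos, hneg] at h1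
  have h2 : (ZMod.stdAddChar (-(2 * j)) : ℂ) = (starRingEnd ℂ) (ZMod.stdAddChar (-j)) := by
    rw [conj_stdAddChar, show (2 : ZMod 3) = -1 from rfl]
    congr 1; ring
  rw [h2, ← map_mul] at h1
  set I := indicatorTransform B (Finset.univ.filter (fun x => f x = j)) β
  have h3I : ((3 : ℕ) : ℂ) * I = 3 * I := by norm_num
  rw [h3I] at h1
  rcases hf β with h0 | hW
  · left
    rw [norm_eq_zero.1 h0] at h1
    simpa using h1
  · obtain ⟨l, hl⟩ := exists_walsh_eq_amplitude (by norm_num) B f (2 * k + 1) β hW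
    have hG := quadratic_gauss_sum (p := 3) (by norm_num)
    have hP := prod_stdAddChar_sub (p := 3) (h := 1) rfl
    rw [Finset.prod_range_one, pow_one] at hP
    norm_num at hG hP
    set G : ℂ := Complex.I * (Real.sqrt 3 : ℂ) with hGdef
    have hG2 : G ^ 2 = -3 := by
      rw [hGdef, mul_pow, Complex.I_sq, ← Complex.ofReal_pow, Real.sq_sqrt (by norm_num)]
      norm_num
    have hGconj : (starRingEnd ℂ) G = -G := by
      rw [hGdef, map_mul, Complex.conj_I, Complex.conj_ofReal, neg_mul]
    obtain ⟨e, he, hW'⟩ : ∃ e : ℂ, (e = 1 ∨ e = -1) ∧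
        walsh B f β = e * (3 ^ k * G * ZMod.stdAddChar l) := by
      have := mu_mul_halfPow_odd (p := 3) (by norm_num) k
      rcases hl with hl | hl <;> rw [this] at hl
      · refine ⟨1, Or.inl rfl, ?_⟩
        rw [hl, ← hG]; norm_num
      · refine ⟨-1, Or.inr rfl, ?_⟩
        rw [hl, ← hG]; norm_num
    have heconj : (starRingEnd ℂ) e = e := by rcases he with rfl | rfl <;> simp
    rw [hW'] at h1
    simp only [map_mul, map_pow, hGconj, heconj, conj_stdAddChar, neg_neg, map_ofNat] at h1
    have h4 : 3 * I = e * 3 ^ k * G *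
        (ZMod.stdAddChar (l - j) - ZMod.stdAddChar (-(l - j))) := by
      rw [h1, show l - j = -j + l by ring, show -(-j + l) = j + -l by ring,
        AddChar.map_add_eq_mul, AddChar.map_add_eq_mul]
      ring
    rcases zmod_three_cases (l - j) with hu | hu | hu
    · left
      rw [hu] at h4
      simpa using h4
    · right
      rw [hu, hP] at h4
      have h5 : I = -(e * 3 ^ k) := by linear_combination h4 / 3 + e * 3 ^ k / 3 * hG2
      rcases he with rfl | rfl
      · right; rw [h5]; ring
      · left; rw [h5]; ring
    · right
      rw [hu, show (2 : ZMod 3) = -1 from rfl, neg_neg, ← neg_sub, hP] at h4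
      have h5 : I = e * 3 ^ k := by linear_combination h4 / 3 - e * 3 ^ k / 3 * hG2
      rcases he with rfl | rfl
      · left; rw [h5]; ring
      · right; rw [h5]; ring

theorem exists_zero_sum_triple_of_five_le (hp : 5 ≤ p) {n : ℕ}
    (hn : Module.finrank (ZMod p) V = n) (hn3 : 3 ≤ n)
    (hD : IsScalarTransversal (p := p) D E)
    (hE : (p : ℤ) ^ n - (p : ℤ) ^ (n - 1) ≤ 2 * (p * E.card)) :
    ∃ x ∈ D, ∃ y ∈ D, ∃ z ∈ D, x + y + z = 0 ∧ ∀ c : ZMod p, y ≠ c • x := by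
  classical
  obtain ⟨x, hx, y, hy, z, hz, h⟩ := exists_zero_sum_triple_of_card (p := p)
    (F := Finset.univ.filter (· ∈ D))
    (fun h => hD.ne_zero (by omega) (Finset.mem_filter.1 h).2 rfl)
    (fun x hx a ha => Finset.mem_filter.2
      ⟨Finset.mem_univ _, hD.smul_mem (Finset.mem_filter.1 hx).2 ha⟩) (by
    rw [← hD.mul_card]
    zify [show 2 ≤ p by omega, show 1 ≤ p by omega]
    rw [card_eq_pow_finrank_zmod (p := p), hn]
    obtain ⟨t, rfl⟩ : ∃ t, n = t + 3 := ⟨n - 3, by omega⟩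
    rw [show t + 3 - 1 = t + 2 by omega] at hE
    have hp5 : (5 : ℤ) ≤ p := by exact_mod_cast hp
    have ht : (1 : ℤ) ≤ (p : ℤ) ^ t := one_le_pow₀ (by linarith)
    rw [pow_add, pow_add] at hE
    rw [pow_add]
    generalize (p : ℤ) ^ t = T at *
    generalize (E.card : ℤ) = c at *
    generalize (p : ℤ) = q at *
    have h1 := mul_le_mul_of_nonneg_left hE (show (0 : ℤ) ≤ q - 1 by linarith)
    -- The size of D beats the packing bound by a margin governed by (p - 1)² - 2p = p² - 4p + 1. It
    -- is negative at p = 3, which therefore needs a separate argument.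
    have h2 : 6 ≤ q ^ 2 - 4 * q + 1 := by nlinarith
    have h3 : q ^ 2 ≤ q ^ 2 * T := by nlinarith [sq_nonneg q]
    have h4 : q ^ 2 * 6 ≤ q ^ 2 * T * (q ^ 2 - 4 * q + 1) :=
      mul_le_mul h3 h2 (by norm_num) (by positivity)
    nlinarith)
  simp only [Finset.mem_filter, Finset.mem_univ, true_and] at hx hy hz
  exact ⟨x, hx, y, hy, z, hz, h⟩

theorem exists_zero_sum_triple_three (hp : p = 3) (hB : B.Nondegenerate) {n : ℕ}
    (hn : Module.finrank (ZMod p) V = n)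
    (hD : IsScalarTransversal (p := p) D E) {j : ZMod p} (hDj : ∀ x, x ∈ D ↔ f x = j)
    (u v : ℝ)
    (huv : ∀ β, β ≠ 0 →
      u * (indicatorTransform B (Finset.univ.filter (fun x => f x = j)) β).re ^ 2 +
        v * (indicatorTransform B (Finset.univ.filter (fun x => f x = j)) β).re ≤
      (indicatorTransform B (Finset.univ.filter (fun x => f x = j)) β).re ^ 3)
    (hE : 0 < E.card)
    (hlt : (3 : ℝ) ^ n < (2 * E.card : ℝ) ^ 2 + u * ((3 : ℝ) ^ n - 2 * E.card) - v) :
    ∃ x ∈ D, ∃ y ∈ D, ∃ z ∈ D, x + y + z = 0 ∧ ∀ c : ZMod p, y ≠ c • x := by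
  classical
  have hF : Finset.univ.filter (· ∈ D) = Finset.univ.filter (fun x => f x = j) :=
    Finset.filter_congr fun x _ => hDj x
  have hcard : (Finset.univ.filter (fun x => f x = j)).card = 2 * E.card := by
    rw [← hF, ← hD.mul_card, hp]
  have hV : (Fintype.card V : ℝ) = 3 ^ n := by
    have := card_eq_pow_finrank_zmod (p := p) (V := V)
    rw [hn, hp] at this
    exact_mod_cast this
  obtain ⟨x, hx, y, hy, z, hz, h⟩ := exists_zero_sum_triple_of_third_moment hp hB
    (F := Finset.univ.filter (fun x => f x = j))
    (fun h => hD.ne_zero (by omega) ((hDj _).2 (Finset.mem_filter.1 h).2) rfl)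
    (Finset.card_pos.1 (by omega))
    (fun x hx => by
      rw [← hF] at hx ⊢
      refine Finset.mem_filter.2 ⟨Finset.mem_univ _, ?_⟩
      rw [← neg_one_smul (ZMod p) x]
      exact hD.smul_mem (Finset.mem_filter.1 hx).2 (neg_ne_zero.2 one_ne_zero))
    u v huv (by rw [hcard, hV]; push_cast; exact hlt)
  simp only [Finset.mem_filter, Finset.mem_univ, true_and, ← hDj] at hx hy hz
  exact ⟨x, hx, y, hy, z, hz, h⟩

theorem exists_zero_sum_triple_even (hp : p ≠ 2) (hB : B.Nondegenerate) {k n : ℕ}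
    (hn : Module.finrank (ZMod p) V = n) (hkn : k + 2 ≤ n) (hk : 1 ≤ k) (hn4 : 4 ≤ n)
    (hf : ∀ α, ‖walsh B f α‖ = 0 ∨ ‖walsh B f α‖ = halfPow p (2 * k)) {e : ℤ}
    (he : e = 1 ∨ e = -1)
    (hD : IsScalarTransversal (p := p) D E) (hDj : p = 3 → ∃ j, ∀ x, x ∈ D ↔ f x = j)
    (hE : 2 * ((p : ℤ) * E.card) = (p : ℤ) ^ n - e * (p : ℤ) ^ k) :
    ∃ x ∈ D, ∃ y ∈ D, ∃ z ∈ D, x + y + z = 0 ∧ ∀ c : ZMod p, y ≠ c • x := by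
  have hpp : p.Prime := Fact.out
  have hp1 : (1 : ℤ) ≤ p := by exact_mod_cast hpp.one_le
  have hek : e * (p : ℤ) ^ k ≤ (p : ℤ) ^ k := by
    have : (0 : ℤ) ≤ (p : ℤ) ^ k := by positivity
    rcases he with rfl | rfl <;> linarith
  by_cases hp3 : p = 3
  · obtain ⟨j, hj⟩ := hDj hp3
    obtain ⟨r, rfl⟩ : ∃ r, k = r + 1 := ⟨k - 1, by omega⟩
    obtain ⟨t, rfl⟩ : ∃ t, n = t + 3 := ⟨n - 3, by omega⟩
    rw [hp3] at hE hek
    have hR : (3 : ℤ) ^ r ≤ 3 ^ t := pow_le_pow_right₀ (by norm_num) (by omega)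
    have hR3 : (3 : ℤ) ^ 1 ≤ 3 ^ t := pow_le_pow_right₀ (by norm_num) (by omega)
    have hr0 : (0 : ℤ) < 3 ^ r := by positivity
    have hN : 8 * (3 : ℤ) ^ t ≤ 2 * E.card := by
      push_cast at hE hek
      rw [pow_succ (3 : ℤ) r, pow_add] at hE
      rw [pow_succ] at hek
      linarith
    have hle : ∀ β, β ≠ 0 →
        |(indicatorTransform B (Finset.univ.filter (fun x => f x = j)) β).re| ≤ 2 * 3 ^ r := by
      intro β hβ
      have h1 := norm_indicatorTransform_le hB hf j hβ
      rw [halfPow_even, show (p : ℝ) = 3 by rw [hp3]; norm_num, pow_succ] at h1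
      refine (Complex.abs_re_le_norm _).trans ?_
      linarith
    -- The transform x satisfies |x| ≤ (2/3) · 3^k = 2 · 3^r, hence x³ ≥ -2 · 3^r x².
    refine exists_zero_sum_triple_three hp3 hB hn hD hj (-(2 * 3 ^ r)) 0 ?_ ?_ ?_
    · intro β hβ
      have h1 := abs_le.1 (hle β hβ)
      set x := (indicatorTransform B (Finset.univ.filter (fun x => f x = j)) β).re
      have h2 := mul_nonneg (sq_nonneg x) (show 0 ≤ x + 2 * 3 ^ r by linarith [h1.1])
      linarith
    · have : (0 : ℤ) < E.card := by linarith
      exact_mod_cast this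
    · have hN' : 8 * (3 : ℝ) ^ t ≤ 2 * E.card := by exact_mod_cast hN
      have hR' : (3 : ℝ) ^ r ≤ 3 ^ t := by exact_mod_cast hR
      have hR3' : (3 : ℝ) ≤ 3 ^ t := by
        have := hR3
        rw [pow_one] at this
        exact_mod_cast this
      have hr0' : (0 : ℝ) < 3 ^ r := by positivity
      have h27 : (3 : ℝ) ^ (t + 3) = 27 * 3 ^ t := by ring
      rw [h27]
      generalize (3 : ℝ) ^ t = R at *
      generalize (3 : ℝ) ^ r = q at *
      generalize (2 * E.card : ℝ) = c at *
      have h1 : (8 * R) * (8 * R) ≤ c ^ 2 := by nlinarith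
      have h2 : q * (27 * R - c) ≤ q * (19 * R) :=
        mul_le_mul_of_nonneg_left (by linarith) hr0'.le
      have h3 : q * (19 * R) ≤ R * (19 * R) := mul_le_mul_of_nonneg_right hR' (by linarith)
      nlinarith
  · have hp5 : 5 ≤ p := by
      have h2 := hpp.two_le
      by_contra hlt
      have : p = 4 := by omega
      rw [this] at hpp
      exact absurd hpp (by norm_num)
    refine exists_zero_sum_triple_of_five_le hp5 hn (by omega) hD ?_
    have : (p : ℤ) ^ k ≤ (p : ℤ) ^ (n - 1) := pow_le_pow_right₀ hp1 (by omega)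
    linarith

theorem exists_zero_sum_triple_odd (hp : p ≠ 2) (hB : B.Nondegenerate) {k n : ℕ}
    (hn : Module.finrank (ZMod p) V = n) (hkn : k + 2 ≤ n) (hn3 : 3 ≤ n)
    (hf : ∀ α, ‖walsh B f α‖ = 0 ∨ ‖walsh B f α‖ = halfPow p (2 * k + 1)) {e : ℤ}
    (he : e = 1 ∨ e = -1) (hexc : ¬ (p = 3 ∧ n = 3 ∧ e = -1))
    (hfneg : p = 3 → ∀ x, f (-x) = f x)
    (hD : IsScalarTransversal (p := p) D E) (hDj : p = 3 → ∃ j, ∀ x, x ∈ D ↔ f x = j)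
    (hE : 2 * ((p : ℤ) * E.card) = (p : ℤ) ^ n + p * (e * (p : ℤ) ^ k)) :
    ∃ x ∈ D, ∃ y ∈ D, ∃ z ∈ D, x + y + z = 0 ∧ ∀ c : ZMod p, y ≠ c • x := by
  have hpp : p.Prime := Fact.out
  have hp1 : (1 : ℤ) ≤ p := by exact_mod_cast hpp.one_le
  by_cases hp3 : p = 3
  · obtain ⟨j, hj⟩ := hDj hp3
    obtain ⟨t, rfl⟩ : ∃ t, n = t + 2 := ⟨n - 2, by omega⟩
    rw [hp3] at hE
    have hN : (2 : ℝ) * E.card = 3 * 3 ^ t + e * 3 ^ k := by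
      have : (2 : ℤ) * E.card = 3 * 3 ^ t + e * 3 ^ k := by
        push_cast at hE
        rw [pow_add] at hE
        linarith
      exact_mod_cast this
    have hkt : (3 : ℝ) ^ k ≤ 3 ^ t := pow_le_pow_right₀ (by norm_num) (by omega)
    have hk0 : (0 : ℝ) < 3 ^ k := by positivity
    have ht3 : (3 : ℝ) ≤ 3 ^ t := by
      calc (3 : ℝ) = 3 ^ 1 := by norm_num
        _ ≤ 3 ^ t := pow_le_pow_right₀ (by norm_num) (by omega)
    -- The transform takes only the values 0 and ±3^k, so its cube is 9^k times itself.
    refine exists_zero_sum_triple_three hp3 hB hn hD hj 0 ((3 ^ k) ^ 2) ?_ ?_ ?_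
    · intro β hβ
      rcases indicatorTransform_three_odd hp3 hB (hfneg hp3) hf j hβ with h | h | h
      · rw [h]; simp
      · have : (3 ^ k : ℂ) = ((3 ^ k : ℝ) : ℂ) := by push_cast; rfl
        rw [h, this, Complex.ofReal_re]
        exact le_of_eq (by ring)
      · have : (-3 ^ k : ℂ) = ((-3 ^ k : ℝ) : ℂ) := by push_cast; rfl
        rw [h, this, Complex.ofReal_re]
        exact le_of_eq (by ring)
    · have : (0 : ℝ) < 2 * E.card := by
        rw [hN]
        rcases he with rfl | rfl <;> push_cast <;> linarith
      have : (0 : ℝ) < E.card := by linarith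
      exact_mod_cast this
    · rw [hN]
      have h9 : (3 : ℝ) ^ (t + 2) = 9 * 3 ^ t := by ring
      rw [h9]
      rcases he with rfl | rfl
      · push_cast
        generalize (3 : ℝ) ^ t = R at *
        generalize (3 : ℝ) ^ k = q at *
        nlinarith
      -- With R = 3^t and q = 3^k ≤ R, the requirement is 9R < 9R² - 6Rq. The bound 9R² - 6Rq ≥ 3R²
      -- suffices once R > 3, that is, n ≥ 4.
      · have ht9 : (9 : ℝ) ≤ 3 ^ t := by
          calc (9 : ℝ) = 3 ^ 2 := by norm_num
            _ ≤ 3 ^ t := pow_le_pow_right₀ (by norm_num) (by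
              by_contra hlt
              exact hexc ⟨hp3, by omega, rfl⟩)
        push_cast
        generalize (3 : ℝ) ^ t = R at *
        generalize (3 : ℝ) ^ k = q at *
        nlinarith
  · have hp5 : 5 ≤ p := by
      have h2 := hpp.two_le
      by_contra hlt
      have : p = 4 := by omega
      rw [this] at hpp
      exact absurd hpp (by norm_num)
    refine exists_zero_sum_triple_of_five_le hp5 hn hn3 hD ?_
    have h1 : (p : ℤ) ^ (k + 1) ≤ (p : ℤ) ^ (n - 1) := pow_le_pow_right₀ hp1 (by omega)
    rw [pow_succ] at h1
    have h2 : (0 : ℤ) ≤ (p : ℤ) ^ k := by positivity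
    have h3 : -((p : ℤ) ^ k * p) ≤ p * (e * (p : ℤ) ^ k) := by
      rcases he with rfl | rfl <;> nlinarith
    linarith

end LevelSets

end PlateauedCode

namespace PlateauedCode

/-! ### Code parameters and the exceptional case. -/

section Parameters

variable {p : ℕ} [Fact p.Prime] {V : Type*} [AddCommGroup V] [Module (ZMod p) V] [Fintype V]
  {B : LinearMap.BilinForm (ZMod p) V} {f : V → ZMod p} {D : Set V} {E : Finset V}

theorem dualCode_parameters (hB : B.Nondegenerate) {n : ℕ}
    (hn : Module.finrank (ZMod p) V = n) (hD : IsScalarTransversal (p := p) D E)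
    {j : ZMod p} (hj : ∀ x, f x = j → x ∈ D)
    (hspan : ∀ a, a ≠ 0 → ∃ x, f x = j ∧ B a x ≠ 0) {N : ℚ} (hN : (E.card : ℚ) = N) :
    (codeLength (dualCode (definingSetCode B E)) : ℚ) = N ∧
      (Module.finrank (ZMod p) (dualCode (definingSetCode B E)) : ℚ) = N - n := by
  have h := finrank_dualCode (B := B) (E := E) hB fun a ha => by
    obtain ⟨x, hx, hax⟩ := hspan a ha
    obtain ⟨c, y, hy, rfl⟩ := hD.exists_smul (hj x hx)
    refine ⟨y, hy, fun h0 => hax ?_⟩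
    rw [map_smul, h0, smul_zero]
  rw [hn] at h
  constructor
  · rw [codeLength, Fintype.card_coe, hN]
  · rw [← hN, ← h]; push_cast; ring

theorem hasMinDist_three_iff_odd (hp : p ≠ 2) (hB : B.Nondegenerate) {k n s : ℕ}
    (hn : Module.finrank (ZMod p) V = n) (hk : n + s = 2 * k + 1) (hs : s + 3 ≤ n)
    (hf : ∀ α, ‖walsh B f α‖ = 0 ∨ ‖walsh B f α‖ = halfPow p (2 * k + 1)) {e : ℤ}
    (he : e = 1 ∨ e = -1) (hfneg : p = 3 → ∀ x, f (-x) = f x)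
    (hD : IsScalarTransversal (p := p) D E) (hDj : p = 3 → ∃ j, ∀ x, x ∈ D ↔ f x = j)
    (hE : 2 * ((p : ℤ) * E.card) = (p : ℤ) ^ n + p * (e * (p : ℤ) ^ k))
    (hdim : Module.finrank (ZMod p) (dualCode (definingSetCode B E)) + n = E.card) :
    HasMinDist (dualCode (definingSetCode B E)) 3 ↔ ¬ (p = 3 ∧ n = 3 ∧ e = -1) := by
  constructor
  · rintro hmin ⟨hp3, hn3, he1⟩
    -- In the exceptional case n = 3 forces s = 0, and 6|E| = 27 - 9 gives |E| = 3 = n: the dual is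
    -- zero.
    have hk1 : k = 1 := by omega
    rw [hp3, hn3, he1, hk1] at hE
    norm_num at hE
    refine not_hasMinDist_of_finrank_eq_zero ?_ 3 hmin
    omega
  · intro hexc
    exact hasMinDist_three hp hB hD (exists_zero_sum_triple_odd hp hB hn (by omega) (by omega) hf he
      hexc hfneg hD hDj hE)

end Parameters

end PlateauedCode

/-! ### Assembly. -/

open PlateauedCode in
theorem proposition7 {p : ℕ} [Fact p.Prime] (hp : p ≠ 2)
    {V : Type*} [AddCommGroup V] [Module (ZMod p) V] [Fintype V]
    (B : LinearMap.BilinForm (ZMod p) V) (hBsymm : B.IsSymm) (hBnd : B.Nondegenerate)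
    (n s : ℕ) (hn : Module.finrank (ZMod p) V = n)
    (hs_even : Even (n + s) → s + 4 ≤ n) (hs_odd : Odd (n + s) → s + 3 ≤ n)
    (f : V → ZMod p) (hf : PlateauedCode.InClassF B f s)
    (Esq Ensq : Finset V)
    (hEsq : PlateauedCode.IsScalarTransversal (p := p) (PlateauedCode.Dsq f) Esq)
    (hEnsq : PlateauedCode.IsScalarTransversal (p := p) (PlateauedCode.Dnsq f) Ensq) :
    let ε : ℚ := (PlateauedCode.walshSign B f s 0 : ℚ)
    let Csq := PlateauedCode.dualCode (PlateauedCode.definingSetCode B Esq)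
    let Cnsq := PlateauedCode.dualCode (PlateauedCode.definingSetCode B Ensq)
    (ε = 1 ∨ ε = -1) ∧
    (Even (n + s) →
      let N : ℚ := ((p : ℚ) ^ (n - 1) - ε * (p : ℚ) ^ ((n + s) / 2 - 1)) / 2
      ((PlateauedCode.codeLength Csq : ℚ) = N ∧
        (Module.finrank (ZMod p) Csq : ℚ) = N - n ∧ PlateauedCode.HasMinDist Csq 3) ∧
      ((PlateauedCode.codeLength Cnsq : ℚ) = N ∧
        (Module.finrank (ZMod p) Cnsq : ℚ) = N - n ∧ PlateauedCode.HasMinDist Cnsq 3)) ∧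
    (Odd (n + s) →
      let Nsq : ℚ := ((p : ℚ) ^ (n - 1) + ε * (p : ℚ) ^ ((n + s - 1) / 2)) / 2
      let Nnsq : ℚ := ((p : ℚ) ^ (n - 1) - ε * (p : ℚ) ^ ((n + s - 1) / 2)) / 2
      ((PlateauedCode.codeLength Csq : ℚ) = Nsq ∧
        (Module.finrank (ZMod p) Csq : ℚ) = Nsq - n ∧
        (PlateauedCode.HasMinDist Csq 3 ↔
          ¬ (p = 3 ∧ n = 3 ∧ 0 ∈ PlateauedCode.Bminus B f s))) ∧
      ((PlateauedCode.codeLength Cnsq : ℚ) = Nnsq ∧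
        (Module.finrank (ZMod p) Cnsq : ℚ) = Nnsq - n ∧
        (PlateauedCode.HasMinDist Cnsq 3 ↔
          ¬ (p = 3 ∧ n = 3 ∧ 0 ∈ PlateauedCode.Bplus B f s)))) := by
  intro ε Csq Cnsq
  have hpp : p.Prime := Fact.out
  have hp0 : (p : ℚ) ≠ 0 := Nat.cast_ne_zero.2 hpp.ne_zero
  have hpl := hf.plateaued.2
  have hnorm := (hpl 0).resolve_left (norm_ne_zero_iff.2 (walsh_zero_ne_zero hp B hEsq))
  obtain ⟨e, j₀, hsign, hw, hcases⟩ := walshSign_of_norm_eq hp B f s 0 hnorm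
  have he : e = 1 ∨ e = -1 := hcases.imp And.left And.left
  have hε : ε = e := by simp only [ε, hsign]
  rw [amplitude, hn] at hw
  rw [hn] at hpl
  -- A single level set inside each of D_{f,sq} and D_{f,nsq} already spans V; the values 1 and a
  -- nonsquare `d` are chosen.
  have hsq1 : ∀ x, f x = 1 → x ∈ Dsq f := fun x hx => by
    rw [Dsq, Set.mem_ofPred_eq, hx]; exact ⟨one_ne_zero, IsSquare.one⟩
  obtain ⟨d, hd⟩ := quadraticChar_exists_neg_one (F := ZMod p)
    (by rwa [ZMod.ringChar_zmod_n])
  have hd0 : d ≠ 0 := by rintro rfl; simp at hd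
  have hnsqd : ∀ x, f x = d → x ∈ Dnsq f := fun x hx => by
    rw [Dnsq, Set.mem_ofPred_eq, hx]
    exact ⟨hd0, quadraticChar_neg_one_iff_not_isSquare.1 hd⟩
  have hDsq3 : p = 3 → ∃ j, ∀ x, x ∈ Dsq f ↔ f x = j := by
    rintro rfl
    exact ⟨1, fun x => (zmod_three_eq_one_iff (f x)).symm⟩
  have hDnsq3 : p = 3 → ∃ j, ∀ x, x ∈ Dnsq f ↔ f x = j := by
    rintro rfl
    exact ⟨2, fun x => (zmod_three_eq_two_iff (f x)).symm⟩
  refine ⟨?_, ?_, ?_⟩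
  · rw [hε]
    rcases he with rfl | rfl <;> simp
  · intro heven N
    have hsn := hs_even heven
    obtain ⟨k, hk⟩ := heven.two_dvd
    rw [hk] at hw hpl
    obtain rfl := eq_zero_of_walsh_zero_even hp B hEsq hEnsq he hw
    obtain ⟨h1, h2⟩ := card_transversal_even hp B hEsq hEnsq hw
    rw [hn] at h1 h2
    obtain ⟨k, rfl⟩ : ∃ l, k = l + 1 := ⟨k - 1, by omega⟩
    obtain ⟨n, rfl⟩ : ∃ l, n = l + 1 := ⟨n - 1, by omega⟩
    have hcard : ∀ c : ℕ, 2 * ((p : ℤ) * c) = (p : ℤ) ^ (n + 1) - e * (p : ℤ) ^ (k + 1) →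
        (c : ℚ) = N := by
      intro c hc
      have hc' : 2 * ((p : ℚ) * c) = (p : ℚ) ^ (n + 1) - e * (p : ℚ) ^ (k + 1) := by
        exact_mod_cast hc
      simp only [N, hε, hk, Nat.mul_div_cancel_left (k + 1) two_pos, Nat.add_sub_cancel]
      refine mul_left_cancel₀ hp0 ?_
      linear_combination hc' / 2
    have hspan : ∀ j : ZMod p, j ≠ 0 → ∀ a, a ≠ 0 → ∃ x, f x = j ∧ B a x ≠ 0 :=
      fun j hj a ha => exists_bilin_ne_zero_even hp hBnd hn (by omega) hpl he hw hj ha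
    have p1 := dualCode_parameters hBnd hn hEsq hsq1 (hspan 1 one_ne_zero) (hcard _ h1)
    have p2 := dualCode_parameters hBnd hn hEnsq hnsqd (hspan d hd0) (hcard _ h2)
    exact ⟨⟨p1.1, p1.2, hasMinDist_three hp hBnd hEsq (exists_zero_sum_triple_even hp hBnd hn
        (by omega) (by omega) (by omega) hpl he hEsq hDsq3 h1)⟩,
      ⟨p2.1, p2.2, hasMinDist_three hp hBnd hEnsq (exists_zero_sum_triple_even hp hBnd hn
        (by omega) (by omega) (by omega) hpl he hEnsq hDnsq3 h2)⟩⟩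
  · intro hodd Nsq Nnsq
    have hsn := hs_odd hodd
    obtain ⟨k, hk⟩ := hodd
    rw [hk] at hw hpl
    obtain rfl := eq_zero_of_walsh_zero_odd hp B hEsq hEnsq he hw
    obtain ⟨h1, h2⟩ := card_transversal_odd hp B hEsq hEnsq hw
    rw [hn] at h1 h2
    -- For n + s odd, the nonsquares behave as the squares with sign -e, which turns the exception 0
    -- ∈ B₋(f) into 0 ∈ B₊(f).
    have h2' : 2 * ((p : ℤ) * Ensq.card) = (p : ℤ) ^ n + p * (-e * (p : ℤ) ^ k) := by
      rw [h2]; ring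
    have hcard : ∀ (c : ℕ) (i : ℤ),
        2 * ((p : ℤ) * c) = (p : ℤ) ^ n + p * (i * (p : ℤ) ^ k) →
        (c : ℚ) = ((p : ℚ) ^ (n - 1) + i * (p : ℚ) ^ ((n + s - 1) / 2)) / 2 := by
      intro c i hc
      have hc' : 2 * ((p : ℚ) * c) = (p : ℚ) ^ n + p * (i * (p : ℚ) ^ k) := by
        exact_mod_cast hc
      rw [hk, Nat.add_sub_cancel, Nat.mul_div_cancel_left k two_pos]
      refine mul_left_cancel₀ hp0 ?_
      have hpow : (p : ℚ) * (p : ℚ) ^ (n - 1) = (p : ℚ) ^ n := by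
        rw [← pow_succ', Nat.sub_add_cancel (by omega)]
      linear_combination hc' / 2 - hpow / 2
    have hspan : ∀ j : ZMod p, j ≠ 0 → ∀ a, a ≠ 0 → ∃ x, f x = j ∧ B a x ≠ 0 :=
      fun j hj a ha => exists_bilin_ne_zero_odd hp hBnd hn (by omega) hpl he hw hj ha
    have c1 : (Esq.card : ℚ) = Nsq := by rw [hcard _ e h1]; simp only [Nsq, hε]
    have c2 : (Ensq.card : ℚ) = Nnsq := by
      rw [hcard _ (-e) h2']; simp only [Nnsq, hε]; push_cast; ring
    have p1 := dualCode_parameters hBnd hn hEsq hsq1 (hspan 1 one_ne_zero) c1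
    have p2 := dualCode_parameters hBnd hn hEnsq hnsqd (hspan d hd0) c2
    have hfneg : p = 3 → ∀ x, f (-x) = f x := fun hp3 => apply_neg_of_transversals hp3 hEsq hEnsq
    have q1 := hasMinDist_three_iff_odd hp hBnd hn hk hsn hpl he hfneg hEsq hDsq3 h1 (by
      have h := p1.2
      rw [← c1] at h
      have h' : (Module.finrank (ZMod p) (dualCode (definingSetCode B Esq)) : ℚ) + n = Esq.card := by
        rw [h]; ring
      exact_mod_cast h')
    have q2 := hasMinDist_three_iff_odd hp hBnd hn hk hsn hpl
      (show -e = 1 ∨ -e = -1 by rcases he with rfl | rfl <;> simp) hfneg hEnsq hDnsq3 h2' (by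
      have h := p2.2
      rw [← c2] at h
      have h' : (Module.finrank (ZMod p) (dualCode (definingSetCode B Ensq)) : ℚ) + n
          = Ensq.card := by rw [h]; ring
      exact_mod_cast h')
    have hminus : e = -1 ↔ 0 ∈ Bminus B f s := by
      rcases hcases with ⟨rfl, -, h⟩ | ⟨rfl, -, h⟩ <;> simp [h]
    have hplus : -e = -1 ↔ 0 ∈ Bplus B f s := by
      rcases hcases with ⟨rfl, h, -⟩ | ⟨rfl, h, -⟩ <;> simp [h]
    rw [hminus] at q1
    rw [hplus] at q2
    exact ⟨⟨p1.1, p1.2, q1⟩, ⟨p2.1, p2.2, q2⟩⟩
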